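/- **Notation.** For $V:(0,\infty)\to\mathbb R$ and a finite set $X\subset\mathbb R^2$ put $\mathcal E[V](X)=\frac12\sum_{x\ne y\in X}V(|x-y|)$ and $\mathcal E[V](N)=\inf\{\mathcal E[V](X):\#X=N\}$. Let $$\overline{\mathcal E}_{\rm sq}[V]=\min_{t>0}\ \lim_{R\to\infty}\frac{\mathcal E[V](t\mathbb Z^2\cap B_R)}{\#(t\mathbb Z^2\cap B_R)},$$ where $B_R$ is the open disc of radius $R$ centred at $0$. For four distinct points let $$\mathcal E_4[V](x_1,x_2,x_3,x_4)=\tfrac12\sum_{i=1}^4V(|x_i-x_{i+1}|)+V(|x_1-x_3|)+V(|x_2-x_4|)$$ (indices modulo $4$). A *quadrilateral* is a $4$-tuple of distinct points such that, if the four points are in convex position, the segments $[x_1,x_3]$ and $[x_2,x_4]$ meet (that is, they are the diagonals of the convex hull); points that are not in convex position may be numbered in any way. $\min\mathcal E_4[V]$ denotes the minimum over all quadrilaterals. For $\beta>0$ let $E^1_\beta=(1-\beta,1+\beta)$, $E^2_\beta=(\sqrt2-\beta,\sqrt2+\beta)$, $E_\beta=E^1_\beta\cup E^2_\beta$, and let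 $\mathcal Q_\beta$ be the set of $4$-tuples with $|x_i-x_{i+1}|\in E^1_\beta$ for all $i$ and $|x_1-x_3|,|x_2-x_4|\in E^2_\beta$. Let $\boxtimes$ be the unit square with its vertices in cyclic order. $V$ is *piecewise $C^2$* on $(0,\infty)$ if there is a set of breakpoints, locally finite in $(0,\infty)$, such that for all $0<a<b$ with no breakpoint in $(a,b)$, $V$ agrees on $(a,b)$ with a function that is $C^2$ on $[a,b]$ (jumps at breakpoints are allowed). Put $W(s)=V(\sqrt s)$, and let $W''_\pm$ be the one-sided second derivatives of $W$. **Theorem.** There are universal constants $C_3\ge1$ and $\alpha_*>0$ such that for all $\alpha,\alpha''>0$ with $\alpha<\alpha''/C_3$ and $\alpha''<\min\{\frac{2-\sqrt2}4,\alpha_*\}$ there is $K=K(\alpha,\alpha'')>0$ with the following property. Let $0<\alpha'<\alpha$ and let $V$ be piecewise $C^2$ on $(0,\infty)$ such that - (0) $\min_{r>0}V(r)=-1$; - (1) $V$ is convex on $E^1_{\alpha''}$ and on $E^2_{\alpha''}$, and strictly convex on $(1-\alpha'',1)$ and on $(\sqrt2,\sqrt2+\alpha'')$; - (2) $W$ is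 differentiable at $1$ and $2$ with $W'(1)+2W'(2)=0$, it has one-sided second derivatives there, and for some $\kappa>0$ each of $W''_-(1)+W''_+(1)+2W'(1)$, $W''_-(2)+W''_+(2)$, $W''_-(1)+W''_+(1)$, $W''_+(1)+4W''_+(2)$, $W''_-(1)+4W''_-(2)$ is greater than $\kappa$; - (3) $\sup_{r\in E_{\alpha'}}V(r)<-\frac{15}{16}$; - (4) $V(r)>-\frac12$ for every $r>0$ with $r\notin(1-\alpha,\sqrt2+\alpha)$; - (5) $V(r)>K$ for $0<r\le1-\alpha$; - (6) $V(r)=0$ for $r\ge\sqrt2+\alpha''$; - (A) up to isometries of $\mathbb R^2$, $\boxtimes$ is the only minimizer of $\mathcal E_4[V]$ in $\mathcal Q_{\alpha''}$. Then the limit and the minimum in the definition of $\overline{\mathcal E}_{\rm sq}[V]$ exist, $\mathcal E[V](N)$ is finite for every $N$ and is attained for every $N$ if $V$ is lower semicontinuous, and there is a constant $C$ (depending on $V$) such that for all $N\ge0$ $$N\,\overline{\mathcal E}_{\rm sq}[V]\le\mathcal E[V](N)\le N\,\overline{\mathcal E}_{\rm sq}[V]+C\,N^{1/2}.$$ Moreover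 $\overline{\mathcal E}_{\rm sq}[V]=\min\mathcal E_4[V]$, and this minimum is attained at $\boxtimes$. -/

import Mathlib

open Set Filter Topology

/-- The Euclidean plane. -/
abbrev Plane : Type := EuclideanSpace ℝ (Fin 2)

/-- The energy of a finite configuration: half the sum of `V (|x - y|)` over ordered pairs of
distinct points. -/
noncomputable def energy (V : ℝ → ℝ) (X : Finset Plane) : ℝ :=
  (1 / 2) * ∑ p ∈ X.offDiag, V (dist p.1 p.2)

/-- The energies of all configurations of `N` distinct points. -/
def configEnergies (V : ℝ → ℝ) (N : ℕ) : Set ℝ :=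
  {e | ∃ X : Finset Plane, X.card = N ∧ energy V X = e}

/-- The optimal energy of `N` points. -/
noncomputable def minEnergy (V : ℝ → ℝ) (N : ℕ) : ℝ :=
  sInf (configEnergies V N)

/-- The square lattice `tℤ²`. -/
def squareLattice (t : ℝ) : Set Plane :=
  {x | ∃ a b : ℤ, x = !₂[t * a, t * b]}

theorem squareLattice_inter_ball_finite {t : ℝ} (ht : 0 < t) (R : ℝ) :
    (squareLattice t ∩ Metric.ball 0 R).Finite := by
  obtain ⟨n, hn⟩ := exists_nat_gt (R / t)
  have hn' : R < n * t := (div_lt_iff₀ ht).1 hn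
  refine ((Set.toFinite (Set.Icc (-(n : ℤ)) n ×ˢ Set.Icc (-(n : ℤ)) n)).image
    (fun p : ℤ × ℤ => (!₂[t * p.1, t * p.2] : Plane))).subset ?_
  rintro x ⟨⟨a, b, rfl⟩, hx⟩
  rw [mem_ball_zero_iff] at hx
  have key : ∀ c : ℤ, |t * (c : ℝ)| < R → c ∈ Set.Icc (-(n : ℤ)) n := by
    intro c hc
    rw [abs_mul, abs_of_pos ht] at hc
    have h1 : |(c : ℝ)| < n := by nlinarith
    have h2 : |c| < (n : ℤ) := by exact_mod_cast h1
    exact abs_le.1 h2.le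
  have h0 := (PiLp.norm_apply_le (!₂[t * (a : ℝ), t * (b : ℝ)] : Plane) 0).trans_lt hx
  have h1 := (PiLp.norm_apply_le (!₂[t * (a : ℝ), t * (b : ℝ)] : Plane) 1).trans_lt hx
  exact ⟨(a, b), ⟨key a (by simpa using h0), key b (by simpa using h1)⟩, rfl⟩

/-- The finite configuration `tℤ² ∩ B_R`, where `B_R` is the open ball of radius `R` at the
origin. -/
noncomputable def latticeBall {t : ℝ} (ht : 0 < t) (R : ℝ) : Finset Plane :=
  (squareLattice_inter_ball_finite ht R).toFinset

/-- `l` is the energy per point of the square lattice `tℤ²`. -/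
def IsLatticeEnergy (V : ℝ → ℝ) {t : ℝ} (ht : 0 < t) (l : ℝ) : Prop :=
  Tendsto (fun R : ℝ => energy V (latticeBall ht R) / ((latticeBall ht R).card : ℝ))
    atTop (𝓝 l)

/-- The energies per point of all square lattices. -/
def latticeEnergies (V : ℝ → ℝ) : Set ℝ :=
  {l | ∃ (t : ℝ) (ht : 0 < t), IsLatticeEnergy V ht l}

/-- The optimal energy per point among all square lattices. -/
noncomputable def squareEnergy (V : ℝ → ℝ) : ℝ :=
  sInf (latticeEnergies V)

/-- The four-point energy; indices are taken modulo `4`, so each of the four sides has weight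
`1/2` and each of the two diagonals has weight `1`. -/
noncomputable def fourPointEnergy (V : ℝ → ℝ) (x : Fin 4 → Plane) : ℝ :=
  (1 / 2) * (∑ i, V (dist (x i) (x (i + 1))) + ∑ i, V (dist (x i) (x (i + 2))))

/-- The unit square, vertices in cyclic order. -/
noncomputable def unitSquare : Fin 4 → Plane :=
  ![!₂[-1 / 2, -1 / 2], !₂[-1 / 2, 1 / 2], !₂[1 / 2, 1 / 2], !₂[1 / 2, -1 / 2]]

/-- Four distinct points, numbered as the vertices of a quadrilateral: when they are in convex
position, the pairs `{x₀, x₂}` and `{x₁, x₃}` that the four-point energy treats as diagonals are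
the diagonals of their convex hull. Four points that are not in convex position may be numbered
in any way. -/
def IsQuadrilateral (x : Fin 4 → Plane) : Prop :=
  Function.Injective x ∧
    (ConvexIndependent ℝ x → (segment ℝ (x 0) (x 2) ∩ segment ℝ (x 1) (x 3)).Nonempty)

/-- The four-point energies of all quadrilaterals. -/
def quadEnergies (V : ℝ → ℝ) : Set ℝ :=
  {e | ∃ x : Fin 4 → Plane, IsQuadrilateral x ∧ fourPointEnergy V x = e}

/-- The interval `(1 - β, 1 + β)`. -/
def sideRange (β : ℝ) : Set ℝ := Ioo (1 - β) (1 + β)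

/-- The interval `(√2 - β, √2 + β)`. -/
def diagRange (β : ℝ) : Set ℝ := Ioo (Real.sqrt 2 - β) (Real.sqrt 2 + β)

/-- Quadrilaterals with all sides within `β` of `1` and both diagonals within `β` of `√2`. -/
def nearSquares (β : ℝ) : Set (Fin 4 → Plane) :=
  {x | (∀ i, dist (x i) (x (i + 1)) ∈ sideRange β) ∧
    dist (x 0) (x 2) ∈ diagRange β ∧ dist (x 1) (x 3) ∈ diagRange β}

/-- The unit square is, up to isometries of the plane, the only minimizer of the four-point energy
among the quadrilaterals in `nearSquares β`. -/
def SquareIsOnlyMinimizer (V : ℝ → ℝ) (β : ℝ) : Prop :=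
  (∀ x ∈ nearSquares β, fourPointEnergy V unitSquare ≤ fourPointEnergy V x) ∧
    ∀ x ∈ nearSquares β, fourPointEnergy V x = fourPointEnergy V unitSquare →
      Congruent x unitSquare

/-- Piecewise `C²` on `(0, ∞)`: away from a set of breakpoints that is locally finite in `(0, ∞)`,
the function is `C²`, and on each interval between breakpoints (bounded away from `0`) it agrees
with a function that is `C²` up to the end points. Jumps at breakpoints are allowed. -/
def PiecewiseC2 (f : ℝ → ℝ) : Prop :=
  ∃ S : Set ℝ, (∀ a b : ℝ, 0 < a → (S ∩ Icc a b).Finite) ∧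
    ∀ a b : ℝ, 0 < a → a < b → Disjoint S (Ioo a b) →
      ∃ g : ℝ → ℝ, ContDiffOn ℝ 2 g (Icc a b) ∧ EqOn f g (Ioo a b)

/-- The first and one-sided second order conditions at `1` and `2` on `W`, with lower bound `κ`;
here `w₁`, `w₂` are the derivatives of `W` at `1`, `2`, and `p₁`, `m₁`, `p₂`, `m₂` are its second
derivatives from the right and from the left at these points. -/
def CriticalConditions (W : ℝ → ℝ) (κ : ℝ) : Prop :=
  ∃ w₁ w₂ p₁ m₁ p₂ m₂ : ℝ,
    HasDerivAt W w₁ 1 ∧ HasDerivAt W w₂ 2 ∧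
    HasDerivWithinAt (deriv W) p₁ (Ioi 1) 1 ∧ HasDerivWithinAt (deriv W) m₁ (Iio 1) 1 ∧
    HasDerivWithinAt (deriv W) p₂ (Ioi 2) 2 ∧ HasDerivWithinAt (deriv W) m₂ (Iio 2) 2 ∧
    w₁ + 2 * w₂ = 0 ∧
    κ < m₁ + p₁ + 2 * w₁ ∧ κ < m₂ + p₂ ∧ κ < m₁ + p₁ ∧
    κ < p₁ + 4 * p₂ ∧ κ < m₁ + 4 * m₂

/-- The conditions on a piecewise `C²`, finite-range potential `V` (only its values on `(0, ∞)`
matter), with parameters `α' < α < α''` and repulsion `K`. -/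
structure FiniteRangeConditions (V : ℝ → ℝ) (α' α α'' K : ℝ) : Prop where
  piecewise : PiecewiseC2 V
  min_eq : IsLeast (V '' Ioi 0) (-1)
  convex_side : ConvexOn ℝ (sideRange α'') V
  convex_diag : ConvexOn ℝ (diagRange α'') V
  strict_side : StrictConvexOn ℝ (Ioo (1 - α'') 1) V
  strict_diag : StrictConvexOn ℝ (Ioo (Real.sqrt 2) (Real.sqrt 2 + α'')) V
  critical : ∃ κ > 0, CriticalConditions (fun s => V (Real.sqrt s)) κ
  well : ∃ m < -(15 / 16 : ℝ), ∀ r ∈ sideRange α' ∪ diagRange α', V r ≤ m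
  outside : ∀ r > 0, r ∉ Ioo (1 - α) (Real.sqrt 2 + α) → -(1 / 2 : ℝ) < V r
  repulsion : ∀ r > 0, r ≤ 1 - α → K < V r
  range : ∀ r ≥ Real.sqrt 2 + α'', V r = 0

/-! Write m = 2V(1) + 2V(√2), the four-point energy of the unit square. The core is the bound E(X) ≥
m·#X for every finite X (`IsSquareLike.le_energy`). Applied to tℤ² ∩ B_R it also shows that no
square lattice beats ℤ², whose energy per point is m; a square grid plus far-away points gives the
upper bound with a boundary error of order √N.

The hypotheses are first condensed into `IsSquareLike` with ε = 3α. If two points are closer than 1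
- ε, the hard core yields a point whose total interaction is positive; deleting it lowers the
energy, and induction on N applies. Otherwise only the bonds, the pairs closer than √2 + ε, can
contribute negatively. Fix a maximal non-crossing set G of bonds (`IsPlanarPart`). A bond outside G
crosses one in G, and separation forces the two to be the diagonals of a near-square
(`isSquarish_of_crossing`), where assumption (A) bounds the four-point energy below by m. Rigidity
of near-squares implies that their oriented diagonals and sides use each oriented bond at most once
(`IsPlanarPart.mul_card_le`).

Let b, g, r count the oriented bonds, those in G and those outside. Since V + 1 ≥ 0, the sum of V +
1 over bonds is at least (m + 4)r, and likewise b ≥ 4r. With b = g + r and m ≤ -3 the sum of V is at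
least (m + 3)r - g ≥ mg/3. The planar bound g ≤ 6N (`IsPlanarPart.card_le`) turns this into 2Nm,
twice the claimed energy.

The planar bound is proved with angles instead of Euler's formula. Each oriented bond of G receives
the angle at its start of the triangle on its left, or π/3 if there is none. These wedges are
disjoint at every vertex, so they sum to at most 2πN, while their average is π/3. -/

/-! ### Signed areas and scalar products in the plane -/

/-- Twice the signed area of the triangle `a b c`. -/
def orient (a b c : Plane) : ℝ :=
  (b 0 - a 0) * (c 1 - a 1) - (b 1 - a 1) * (c 0 - a 0)

/-- The inner product of `b - a` and `c - a`. -/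
def dotAt (a b c : Plane) : ℝ :=
  (b 0 - a 0) * (c 0 - a 0) + (b 1 - a 1) * (c 1 - a 1)

theorem orient_rotate (a b c : Plane) : orient b c a = orient a b c := by
  unfold orient; ring

theorem dist_sq_eq (a b : Plane) : dist a b ^ 2 = (a 0 - b 0) ^ 2 + (a 1 - b 1) ^ 2 := by
  rw [EuclideanSpace.dist_eq, Real.sq_sqrt (by positivity), Fin.sum_univ_two, Real.dist_eq,
    Real.dist_eq, sq_abs, sq_abs]

theorem plane_ext {a b : Plane} (h0 : a 0 = b 0) (h1 : a 1 = b 1) : a = b := by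
  ext i; fin_cases i <;> assumption

theorem dotAt_eq (a b c : Plane) :
    dotAt a b c = (dist a b ^ 2 + dist a c ^ 2 - dist b c ^ 2) / 2 := by
  simp only [dist_sq_eq, dotAt]; ring

theorem orient_sq (a b c : Plane) :
    orient a b c ^ 2 = dist a b ^ 2 * dist a c ^ 2 - dotAt a b c ^ 2 := by
  simp only [dist_sq_eq, dotAt, orient]; ring

/-- Two points on the same side of the line `p q`, at almost the same distances from `p` and from
`q`, are close to each other. -/
theorem dist_lt_of_same_side {p q z w : Plane} {h : ℝ} (h0 : 0 < h) (hh : 9 / 10 ≤ h)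
    (hpq1 : 9 / 10 ≤ dist p q ^ 2) (hpq2 : dist p q ^ 2 ≤ 21 / 10)
    (hpz : dist p z ^ 2 ≤ 21 / 10) (hqz : dist q z ^ 2 ≤ 21 / 10)
    (hpw : dist p w ^ 2 ≤ 21 / 10) (hqw : dist q w ^ 2 ≤ 21 / 10)
    (hp : |dist p z ^ 2 - dist p w ^ 2| ≤ 1 / 10) (hq : |dist q z ^ 2 - dist q w ^ 2| ≤ 1 / 10)
    (hs : 0 < orient p q z * orient p q w) : dist z w < h := by
  -- The vector from w to z is resolved along and across the line through p and q, both components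
  -- scaled by |pq|.
  have e : dist p q ^ 2 * dist z w ^ 2 =
      (dotAt p q z - dotAt p q w) ^ 2 + (orient p q z - orient p q w) ^ 2 := by
    simp only [dist_sq_eq, dotAt, orient]; ring
  have o1 := orient_sq p q z
  have o2 := orient_sq p q w
  have d1 := dotAt_eq p q z
  have d2 := dotAt_eq p q w
  set L := dist p q ^ 2
  set A := dist p z ^ 2
  set B := dist q z ^ 2
  set A' := dist p w ^ 2
  set B' := dist q w ^ 2
  have hA : 0 ≤ A := by positivity
  have hB : 0 ≤ B := by positivity
  have hA' : 0 ≤ A' := by positivity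
  have hB' : 0 ≤ B' := by positivity
  rw [abs_le] at hp hq
  set x := orient p q z
  set y := orient p q w
  set u := dotAt p q z
  set v := dotAt p q w
  have huv : |u - v| ≤ 1 / 10 := by rw [abs_le]; constructor <;> linarith
  have hus : |u + v| ≤ 42 / 10 := by rw [abs_le]; constructor <;> linarith
  have h1 : |x ^ 2 - y ^ 2| ≤ 21 / 10 * (1 / 10) + 1 / 10 * (42 / 10) := by
    have : x ^ 2 - y ^ 2 = L * (A - A') - (u - v) * (u + v) := by rw [o1, o2]; ring
    rw [this]
    refine (abs_sub _ _).trans ?_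
    rw [abs_mul, abs_mul]
    have : |A - A'| ≤ 1 / 10 := abs_le.2 hp
    have hL : |L| ≤ 21 / 10 := by rw [abs_le]; constructor <;> linarith
    gcongr
  -- Here x and y have the same sign, so |x - y| ≤ |x + y|.
  have h2 : (x - y) ^ 2 ≤ |x ^ 2 - y ^ 2| := by
    rw [show x ^ 2 - y ^ 2 = (x - y) * (x + y) by ring, abs_mul, ← sq_abs, sq]
    refine mul_le_mul_of_nonneg_left (sq_le_sq.1 ?_) (abs_nonneg _)
    linarith
  have h3 : (u - v) ^ 2 ≤ 1 / 100 := by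
    rw [← sq_abs]; nlinarith [abs_nonneg (u - v)]
  have : dist z w ^ 2 < h ^ 2 := by nlinarith [sq_nonneg (dist z w)]
  exact lt_of_pow_lt_pow_left₀ 2 h0.le this

/-! ### Crossing segments and convex combinations -/

/-- Stewart's theorem. -/
theorem stewart {a b o : Plane} {s : ℝ} (c : Plane) (ho : o = AffineMap.lineMap a b s) :
    dist c o ^ 2 = (1 - s) * dist c a ^ 2 + s * dist c b ^ 2 - s * (1 - s) * dist a b ^ 2 := by
  subst ho
  simp only [dist_sq_eq, AffineMap.lineMap_apply, vsub_eq_sub, vadd_eq_add, PiLp.add_apply,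
    PiLp.smul_apply, PiLp.sub_apply, smul_eq_mul]
  ring

theorem sqrt_two_mem : Real.sqrt 2 ∈ Ioo (1.4142 : ℝ) 1.4143 := by
  constructor
  · exact Real.lt_sqrt_of_sq_lt (by norm_num)
  · rw [Real.sqrt_lt' (by norm_num)]; norm_num

/-- By Stewart, |co|² ≥ (1 - ε)² - |ab|²/4, since s(1 - s) ≤ 1/4; this is about 1 - 1/2. -/
theorem dist_crossing_ge {a b c o : Plane} {ε : ℝ} (h0 : 0 < ε) (h1 : ε ≤ 1 / 1000)
    (ho : o ∈ segment ℝ a b) (hca : 1 - ε ≤ dist c a) (hcb : 1 - ε ≤ dist c b)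
    (hab : dist a b ≤ Real.sqrt 2 + ε) : Real.sqrt 2 / 2 - 5 * ε ≤ dist c o := by
  rw [segment_eq_image_lineMap] at ho
  obtain ⟨s, ⟨hs0, hs1⟩, hs⟩ := ho
  have st := stewart c hs.symm
  obtain ⟨q1, q2⟩ := sqrt_two_mem
  have q := Real.sq_sqrt (show (0 : ℝ) ≤ 2 by norm_num)
  have A : (1 - ε) ^ 2 ≤ dist c a ^ 2 := pow_le_pow_left₀ (by linarith) hca 2
  have B : (1 - ε) ^ 2 ≤ dist c b ^ 2 := pow_le_pow_left₀ (by linarith) hcb 2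
  have C : dist a b ^ 2 ≤ (Real.sqrt 2 + ε) ^ 2 := pow_le_pow_left₀ dist_nonneg hab 2
  have D : s * (1 - s) ≤ 1 / 4 := by nlinarith [sq_nonneg (2 * s - 1)]
  have E : s * (1 - s) * dist a b ^ 2 ≤ 1 / 4 * (Real.sqrt 2 + ε) ^ 2 := by
    gcongr
  have F : (1 - ε) ^ 2 - 1 / 4 * (Real.sqrt 2 + ε) ^ 2 ≤ dist c o ^ 2 := by
    nlinarith
  refine le_of_sq_le_sq ?_ dist_nonneg
  refine le_trans ?_ F
  nlinarith

/-- The numerical half of `side_le_of_crossing`: r is √2, x and y are the distances from c to a and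
b, z is |ab|, and w is the distance from c to the crossing point. -/
theorem side_arith {r ε s x y z w : ℝ} (q : r ^ 2 = 2) (q2 : r < 1.4143)
    (h0 : 0 < ε) (h1 : ε ≤ 1 / 1000) (hs0 : 0 ≤ s) (s4 : 0.45 ≤ 1 - s)
    (hy : 1 - ε ≤ y) (hz : 0 ≤ z) (hz' : z ≤ r + ε) (hw : 0 ≤ w) (hw' : w ≤ r / 2 + 6 * ε)
    (st : w ^ 2 = (1 - s) * x ^ 2 + s * y ^ 2 - s * (1 - s) * z ^ 2) : x < 1 + 16 * ε := by
  have hw2 : w ^ 2 ≤ (r / 2 + 6 * ε) ^ 2 := pow_le_pow_left₀ hw hw' 2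
  have B : (1 - ε) ^ 2 ≤ y ^ 2 := pow_le_pow_left₀ (by linarith) hy 2
  have C : z ^ 2 ≤ (r + ε) ^ 2 := pow_le_pow_left₀ hz hz' 2
  have D : s * (1 - s) ≤ 1 / 4 := by linarith [sq_nonneg (2 * s - 1)]
  have hs1 : s ≤ 1 := by linarith
  have E : s * (1 - s) * z ^ 2 ≤ 1 / 4 * (r + ε) ^ 2 := by gcongr
  have hε : ε ^ 2 ≤ ε / 1000 := by nlinarith only [h0, h1]
  have hε2 : r * ε ≤ 1.4143 * ε := by gcongr
  have F1 : w ^ 2 ≤ 1 / 2 + 9 * ε := by linarith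
  have F2 : s * (1 - s) * z ^ 2 ≤ 1 / 2 + ε := by linarith
  have F3 : s * (1 - ε) ^ 2 ≤ s * y ^ 2 := by gcongr
  have F4 : s * (2 * ε) ≤ 1 * (2 * ε) := by gcongr
  have F5 : 0 ≤ s * ε ^ 2 := by positivity
  have G : (1 - s) * (x ^ 2 - 1) ≤ 12 * ε := by linarith
  by_contra h
  push Not at h
  have H : (1 + 16 * ε) ^ 2 ≤ x ^ 2 := pow_le_pow_left₀ (by linarith) h 2
  -- Since 0.45 · 32 = 14.4 exceeds the 12 in `G`, the factor 16 suffices.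
  have I : 0.45 * (32 * ε) ≤ (1 - s) * (x ^ 2 - 1) := by
    refine mul_le_mul s4 ?_ (by positivity) (by linarith)
    nlinarith only [H, h0]
  linarith

/-- Each half of a diagonal is at least about √2/2 and the whole is at most about √2, so the
diagonals nearly bisect each other. Stewart's identity can then be solved for the side. -/
theorem side_le_of_crossing {a b c d o : Plane} {ε : ℝ} (h0 : 0 < ε) (h1 : ε ≤ 1 / 1000)
    (ho : o ∈ segment ℝ a b) (ho' : o ∈ segment ℝ c d)
    (hca : 1 - ε ≤ dist c a) (hcb : 1 - ε ≤ dist c b)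
    (hda : 1 - ε ≤ dist d a) (hdb : 1 - ε ≤ dist d b)
    (hab : dist a b ≤ Real.sqrt 2 + ε) (hcd : dist c d ≤ Real.sqrt 2 + ε) :
    dist c a < 1 + 16 * ε := by
  have k1 := dist_crossing_ge h0 h1 ho hda hdb hab
  have k2 := dist_crossing_ge h0 h1 ho' (by rwa [dist_comm]) (by rwa [dist_comm])
    hcd (c := a)
  have k3 := dist_crossing_ge h0 h1 ho' (by rwa [dist_comm]) (by rwa [dist_comm])
    hcd (c := b)
  have s2 := dist_add_dist_of_mem_segment ho'
  rw [segment_eq_image_lineMap] at ho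
  obtain ⟨s, ⟨hs0, hs1⟩, hs⟩ := ho
  have st := stewart c hs.symm
  have l1 : dist a o = s * dist a b := by
    rw [← hs, dist_comm, dist_lineMap_left, Real.norm_of_nonneg hs0]
  have l2 : dist b o = (1 - s) * dist a b := by
    rw [← hs, dist_comm, dist_lineMap_right, Real.norm_of_nonneg (by linarith)]
  obtain ⟨q1, q2⟩ := sqrt_two_mem
  have q := Real.sq_sqrt (show (0 : ℝ) ≤ 2 by norm_num)
  have hco : dist c o ≤ Real.sqrt 2 / 2 + 6 * ε := by
    rw [dist_comm o d] at s2; linarith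
  have s4 : (0.45 : ℝ) ≤ 1 - s := by
    by_contra h
    have : (1 - s) * dist a b ≤ 0.45 * (Real.sqrt 2 + ε) := by
      gcongr; linarith
    linarith
  exact side_arith q q2 h0 h1 hs0 s4 hcb dist_nonneg hab dist_nonneg hco st

theorem diag_gt_of_crossing {a b c d o : Plane} {ε : ℝ} (h0 : 0 < ε) (h1 : ε ≤ 1 / 1000)
    (ho : o ∈ segment ℝ a b) (ho' : o ∈ segment ℝ c d)
    (hca : 1 - ε ≤ dist c a) (hcb : 1 - ε ≤ dist c b)
    (hda : 1 - ε ≤ dist d a) (hdb : 1 - ε ≤ dist d b)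
    (hab : dist a b ≤ Real.sqrt 2 + ε) :
    Real.sqrt 2 - 16 * ε < dist c d := by
  have k1 := dist_crossing_ge h0 h1 ho hda hdb hab
  have k2 := dist_crossing_ge h0 h1 ho hca hcb hab
  have s2 := dist_add_dist_of_mem_segment ho'
  rw [dist_comm o d] at s2; linarith

/-- A convex combination of three points of a set of diameter about `√2` has distance less than
about `1` to one of them. -/
theorem sum_smul_ne_of_far {ι : Type*} {t : Finset ι} (ht : t.card ≤ 3) {w : ι → ℝ}
    (hw0 : ∀ i ∈ t, 0 ≤ w i) (hw1 : ∑ i ∈ t, w i = 1) {x : ι → Plane} {p : Plane}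
    (h1 : ∀ i ∈ t, 9 / 10 ≤ dist p (x i) ^ 2)
    (h2 : ∀ i ∈ t, ∀ j ∈ t, dist (x i) (x j) ^ 2 ≤ 21 / 10) : ∑ i ∈ t, w i • x i ≠ p := by
  intro hp
  have hc : ∀ k : Fin 2, ∑ i ∈ t, w i * (x i k - p k) = 0 := by
    intro k
    have : (∑ i ∈ t, w i • x i) k = p k := by rw [hp]
    simp only [WithLp.ofLp_sum, Finset.sum_apply, PiLp.smul_apply, smul_eq_mul] at this
    simp only [mul_sub, Finset.sum_sub_distrib, ← Finset.sum_mul, hw1, one_mul, this, sub_self]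
  have hz : ∑ i ∈ t, ∑ j ∈ t, w i * w j * dotAt p (x i) (x j) = 0 := by
    have : ∀ i ∈ t, ∑ j ∈ t, w i * w j * dotAt p (x i) (x j) = 0 := by
      intro i _
      have : ∑ j ∈ t, w i * w j * dotAt p (x i) (x j) =
          w i * (x i 0 - p 0) * ∑ j ∈ t, w j * (x j 0 - p 0) +
          w i * (x i 1 - p 1) * ∑ j ∈ t, w j * (x j 1 - p 1) := by
        rw [Finset.mul_sum, Finset.mul_sum, ← Finset.sum_add_distrib]
        refine Finset.sum_congr rfl fun j _ => ?_
        unfold dotAt; ring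
      rw [this, hc, hc]; ring
    exact Finset.sum_eq_zero this
  have hdot : ∀ i ∈ t, ∀ j ∈ t, -(3 / 20 : ℝ) ≤ dotAt p (x i) (x j) := by
    intro i hi j hj
    rw [dotAt_eq]
    linarith [h1 i hi, h1 j hj, h2 i hi j hj]
  have hrow : ∀ i ∈ t, -(3 / 20 : ℝ) * w i + 21 / 20 * w i ^ 2 ≤
      ∑ j ∈ t, w i * w j * dotAt p (x i) (x j) := by
    intro i hi
    have hii : 9 / 10 ≤ dotAt p (x i) (x i) := by
      rw [dotAt_eq, dist_self]; linarith [h1 i hi]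
    have e1 : -(3 / 20 : ℝ) * w i = ∑ j ∈ t, w i * w j * (-(3 / 20)) := by
      rw [← Finset.sum_mul, ← Finset.mul_sum, hw1]; ring
    have e2 : w i ^ 2 * (dotAt p (x i) (x i) + 3 / 20) ≤
        ∑ j ∈ t, w i * w j * (dotAt p (x i) (x j) + 3 / 20) := by
      have := Finset.single_le_sum (f := fun j => w i * w j * (dotAt p (x i) (x j) + 3 / 20))
        (fun j hj => mul_nonneg (mul_nonneg (hw0 i hi) (hw0 j hj))
          (by linarith [hdot i hi j hj])) hi
      simpa only [← sq] using this
    have e3 : 21 / 20 * w i ^ 2 ≤ w i ^ 2 * (dotAt p (x i) (x i) + 3 / 20) := by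
      nlinarith [sq_nonneg (w i)]
    have e4 : ∑ j ∈ t, w i * w j * dotAt p (x i) (x j) = ∑ j ∈ t, w i * w j * (-(3 / 20)) +
        ∑ j ∈ t, w i * w j * (dotAt p (x i) (x j) + 3 / 20) := by
      rw [← Finset.sum_add_distrib]
      exact Finset.sum_congr rfl fun j _ => by ring
    linarith
  have hs := Finset.sum_le_sum hrow
  rw [hz, Finset.sum_add_distrib, ← Finset.mul_sum, ← Finset.mul_sum, hw1] at hs
  -- At most three weights of sum 1 have square sum at least 1/3, so the vanishing double sum would
  -- be at least -3/20 + 21/60 > 0.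
  have hcs := sq_sum_le_card_mul_sum_sq (s := t) (f := w)
  rw [hw1] at hcs
  have hn : (t.card : ℝ) ≤ 3 := by exact_mod_cast ht
  have hpos : 0 ≤ ∑ i ∈ t, w i ^ 2 := Finset.sum_nonneg fun i _ => sq_nonneg _
  nlinarith

/-! ### Near-squares and their rigidity -/

/-- `a b c d` are, in counterclockwise order, the vertices of a quadrilateral that differs by at
most `16 ε` from a unit square. -/
structure IsSquarish (ε : ℝ) (a b c d : Plane) : Prop where
  ab : dist a b ∈ sideRange (16 * ε)
  bc : dist b c ∈ sideRange (16 * ε)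
  cd : dist c d ∈ sideRange (16 * ε)
  da : dist d a ∈ sideRange (16 * ε)
  ac : dist a c ∈ diagRange (16 * ε)
  bd : dist b d ∈ diagRange (16 * ε)
  abc : 0 < orient a b c
  bcd : 0 < orient b c d
  cda : 0 < orient c d a
  dab : 0 < orient d a b

theorem IsSquarish.rotate {ε : ℝ} {a b c d : Plane} (h : IsSquarish ε a b c d) :
    IsSquarish ε b c d a :=
  ⟨h.bc, h.cd, h.da, h.ab, h.bd, by rw [dist_comm]; exact h.ac, h.bcd, h.cda, h.dab, h.abc⟩

theorem sq_mem_of_side {ε r : ℝ} (h0 : 0 < ε) (h1 : ε ≤ 1 / 1000) (hr : r ∈ sideRange (16 * ε)) :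
    r ^ 2 ∈ Icc (0.96 : ℝ) 1.04 := by
  obtain ⟨h2, h3⟩ := hr
  constructor <;> nlinarith

theorem sq_mem_of_diag {ε r : ℝ} (h0 : 0 < ε) (h1 : ε ≤ 1 / 1000) (hr : r ∈ diagRange (16 * ε)) :
    r ^ 2 ∈ Icc (1.95 : ℝ) 2.05 := by
  obtain ⟨h2, h3⟩ := hr
  obtain ⟨q1, q2⟩ := sqrt_two_mem
  constructor <;> nlinarith

theorem orient_sq_pos {a b c : Plane} (hab : dist a b ^ 2 ∈ Icc (1.95 : ℝ) 2.05)
    (hac : dist a c ^ 2 ∈ Icc (0.96 : ℝ) 1.04) (hbc : dist b c ^ 2 ∈ Icc (0.96 : ℝ) 1.04) :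
    0 < orient a b c ^ 2 := by
  rw [orient_sq, dotAt_eq]
  obtain ⟨h1, h2⟩ := hab
  obtain ⟨h3, h4⟩ := hac
  obtain ⟨h5, h6⟩ := hbc
  have h7 : 1.95 * 0.96 ≤ dist a b ^ 2 * dist a c ^ 2 := by gcongr
  have h8 : ((dist a b ^ 2 + dist a c ^ 2 - dist b c ^ 2) / 2) ^ 2 ≤ 1.1 ^ 2 :=
    pow_le_pow_left₀ (by linarith) (by linarith) 2
  linarith

/-- Pairs of distinct points, all four distinct, whose segments meet. -/
def Crosses (e f : Plane × Plane) : Prop :=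
  (e.1 ≠ f.1 ∧ e.1 ≠ f.2 ∧ e.2 ≠ f.1 ∧ e.2 ≠ f.2) ∧
    (segment ℝ e.1 e.2 ∩ segment ℝ f.1 f.2).Nonempty

theorem Crosses.symm {e f : Plane × Plane} (h : Crosses e f) : Crosses f e :=
  ⟨⟨h.1.1.symm, h.1.2.2.1.symm, h.1.2.1.symm, h.1.2.2.2.symm⟩, by rw [inter_comm]; exact h.2⟩

theorem Crosses.swap_left {e f : Plane × Plane} (h : Crosses e f) : Crosses e.swap f :=
  ⟨⟨h.1.2.2.1, h.1.2.2.2, h.1.1, h.1.2.1⟩, by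
    simp only [Prod.fst_swap, Prod.snd_swap]; rw [segment_symm]; exact h.2⟩

theorem not_crosses_self (e : Plane × Plane) : ¬Crosses e e := fun h => h.1.1 rfl

theorem orient_eq_zero_of_mem_segment {a b o : Plane} (h : o ∈ segment ℝ a b) :
    orient a b o = 0 := by
  rw [segment_eq_image_lineMap] at h
  obtain ⟨s, -, rfl⟩ := h
  simp only [orient, AffineMap.lineMap_apply, vsub_eq_sub, vadd_eq_add, PiLp.add_apply,
    PiLp.smul_apply, PiLp.sub_apply, smul_eq_mul]
  ring

theorem orient_lineMap (a b c d : Plane) (t : ℝ) :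
    orient a b (AffineMap.lineMap c d t) = (1 - t) * orient a b c + t * orient a b d := by
  simp only [orient, AffineMap.lineMap_apply, vsub_eq_sub, vadd_eq_add, PiLp.add_apply,
    PiLp.smul_apply, PiLp.sub_apply, smul_eq_mul]
  ring

/-- The signed area is affine along cd and vanishes at the common point, so its nonzero end values
have opposite signs. -/
theorem orient_mul_orient_neg {a b c d : Plane}
    (h : (segment ℝ a b ∩ segment ℝ c d).Nonempty)
    (hc : 0 < orient a b c ^ 2) (hd : 0 < orient a b d ^ 2) :
    orient a b c * orient a b d < 0 := by
  obtain ⟨o, ho, ho'⟩ := h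
  have h0 := orient_eq_zero_of_mem_segment ho
  rw [segment_eq_image_lineMap] at ho'
  obtain ⟨t, ⟨t0, t1⟩, rfl⟩ := ho'
  rw [orient_lineMap] at h0
  have hne : orient a b c * orient a b d ≠ 0 :=
    mul_ne_zero (by rintro h; simp [h] at hc) (by rintro h; simp [h] at hd)
  rcases lt_or_gt_of_ne hne with h | h
  · exact h
  · exfalso
    have e : (1 - t) * orient a b c ^ 2 + t * (orient a b c * orient a b d) = 0 := by
      linear_combination orient a b c * h0
    rcases t0.eq_or_lt with rfl | ht
    · simp only [sub_zero, one_mul, zero_mul, add_zero] at e; linarith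
    · nlinarith [mul_pos ht h, mul_nonneg (sub_nonneg.2 t1) hc.le]

/-- Two crossing segments of length at most about `√2` whose end points have mutual distance at
least about `1` are the diagonals of a quadrilateral that is close to a unit square. -/
theorem isSquarish_of_crossing {a b c d : Plane} {ε : ℝ} (h0 : 0 < ε) (h1 : ε ≤ 1 / 1000)
    (h : (segment ℝ a b ∩ segment ℝ c d).Nonempty)
    (hca : 1 - ε ≤ dist c a) (hcb : 1 - ε ≤ dist c b)
    (hda : 1 - ε ≤ dist d a) (hdb : 1 - ε ≤ dist d b)
    (hab : dist a b ≤ Real.sqrt 2 + ε) (hcd : dist c d ≤ Real.sqrt 2 + ε) :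
    IsSquarish ε a c b d ∨ IsSquarish ε a d b c := by
  obtain ⟨o, ho, ho'⟩ := id h
  have ho2 : o ∈ segment ℝ b a := by rwa [segment_symm]
  have ho2' : o ∈ segment ℝ d c := by rwa [segment_symm]
  have sca : dist c a ∈ sideRange (16 * ε) :=
    ⟨by linarith, side_le_of_crossing h0 h1 ho ho' hca hcb hda hdb hab hcd⟩
  have sda : dist d a ∈ sideRange (16 * ε) :=
    ⟨by linarith, side_le_of_crossing h0 h1 ho ho2' hda hdb hca hcb hab (by rwa [dist_comm])⟩
  have scb : dist c b ∈ sideRange (16 * ε) :=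
    ⟨by linarith, side_le_of_crossing h0 h1 ho2 ho' hcb hca hdb hda (by rwa [dist_comm]) hcd⟩
  have sdb : dist d b ∈ sideRange (16 * ε) :=
    ⟨by linarith, side_le_of_crossing h0 h1 ho2 ho2' hdb hda hcb hca (by rwa [dist_comm])
      (by rwa [dist_comm])⟩
  have dcd : dist c d ∈ diagRange (16 * ε) :=
    ⟨diag_gt_of_crossing h0 h1 ho ho' hca hcb hda hdb hab, by linarith⟩
  have dab : dist a b ∈ diagRange (16 * ε) :=
    ⟨diag_gt_of_crossing h0 h1 ho' ho (by rwa [dist_comm]) (by rwa [dist_comm])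
      (by rwa [dist_comm]) (by rwa [dist_comm]) hcd, by linarith⟩
  have S : ∀ {x y : Plane}, dist x y ∈ sideRange (16 * ε) → dist y x ∈ sideRange (16 * ε) :=
    fun h => by rwa [dist_comm]
  have T : ∀ {x y : Plane}, dist x y ∈ diagRange (16 * ε) → dist y x ∈ diagRange (16 * ε) :=
    fun h => by rwa [dist_comm]
  have D := fun {r} => @sq_mem_of_diag ε r h0 h1
  have I := fun {r} => @sq_mem_of_side ε r h0 h1
  have o1 := orient_mul_orient_neg h (orient_sq_pos (D dab) (I (S sca)) (I (S scb)))
    (orient_sq_pos (D dab) (I (S sda)) (I (S sdb)))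
  rw [inter_comm] at h
  have o2 := orient_mul_orient_neg h (orient_sq_pos (D dcd) (I sca) (I sda))
    (orient_sq_pos (D dcd) (I scb) (I sdb))
  have e : orient a b d - orient a b c = orient c d a - orient c d b := by unfold orient; ring
  have e1 : orient a c b = -orient a b c := by unfold orient; ring
  have e2 : orient c b d = -orient c d b := by unfold orient; ring
  have e3 : orient b d a = orient a b d := by unfold orient; ring
  have e4 : orient d a c = orient c d a := by unfold orient; ring
  have f1 : orient a d b = -orient a b d := by unfold orient; ring
  have f2 : orient d b c = orient c d b := by unfold orient; ring
  have f3 : orient b c a = orient a b c := by unfold orient; ring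
  have f4 : orient c a d = -orient c d a := by unfold orient; ring
  -- The side of ab on which c lies decides which of the two cyclic orders is counterclockwise.
  rcases lt_or_gt_of_ne (show orient a b c ≠ 0 by rintro h; simp [h] at o1) with hc | hc
  · have hd : 0 < orient a b d := pos_of_mul_neg_right o1 hc.le
    have h4 : 0 < orient c d a := by
      by_contra h5; push Not at h5; nlinarith
    have h5 : orient c d b < 0 := neg_of_mul_neg_right o2 h4.le
    exact Or.inl ⟨S sca, scb, S sdb, sda, dab, dcd, by linarith, by linarith, by linarith,
      by linarith⟩
  · have hd : orient a b d < 0 := neg_of_mul_neg_right o1 hc.le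
    have h4 : orient c d a < 0 := by
      by_contra h5; push Not at h5; nlinarith
    have h5 : 0 < orient c d b := pos_of_mul_neg_right o2 h4.le
    exact Or.inr ⟨S sda, sdb, S scb, sca, dab, T dcd, by linarith, by linarith, by linarith,
      by linarith⟩

/-- The vertices `a`, `b` of a squarish quadrilateral determine `c`. -/
theorem IsSquarish.third_eq {ε : ℝ} {a b c d c' d' : Plane} (h0 : 0 < ε) (h1 : ε ≤ 1 / 1000)
    (h : IsSquarish ε a b c d) (h' : IsSquarish ε a b c' d')
    (hs : c ≠ c' → 1 - ε ≤ dist c c') : c = c' := by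
  by_contra hne
  have D := fun {r} => @sq_mem_of_diag ε r h0 h1
  have I := fun {r} => @sq_mem_of_side ε r h0 h1
  obtain ⟨a1, a2⟩ := I h.ab
  obtain ⟨b1, b2⟩ := I h.bc
  obtain ⟨c1, c2⟩ := D h.ac
  obtain ⟨b1', b2'⟩ := I h'.bc
  obtain ⟨c1', c2'⟩ := D h'.ac
  have := dist_lt_of_same_side (h := 1 - ε) (by linarith) (by linarith) (by linarith)
    (by linarith) (by linarith) (by linarith) (by linarith) (by linarith)
    (by rw [abs_le]; constructor <;> linarith) (by rw [abs_le]; constructor <;> linarith)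
    (mul_pos h.abc h'.abc)
  linarith [hs hne]

/-- The vertices `a`, `b` of a squarish quadrilateral determine `d`. -/
theorem IsSquarish.fourth_eq {ε : ℝ} {a b c d c' d' : Plane} (h0 : 0 < ε) (h1 : ε ≤ 1 / 1000)
    (h : IsSquarish ε a b c d) (h' : IsSquarish ε a b c' d')
    (hs : d ≠ d' → 1 - ε ≤ dist d d') : d = d' := by
  by_contra hne
  have D := fun {r} => @sq_mem_of_diag ε r h0 h1
  have I := fun {r} => @sq_mem_of_side ε r h0 h1
  obtain ⟨a1, a2⟩ := I h.ab
  obtain ⟨b1, b2⟩ := I h.da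
  obtain ⟨c1, c2⟩ := D h.bd
  obtain ⟨b1', b2'⟩ := I h'.da
  obtain ⟨c1', c2'⟩ := D h'.bd
  rw [dist_comm d a] at b1 b2
  rw [dist_comm d' a] at b1' b2'
  have := dist_lt_of_same_side (p := a) (q := b) (z := d) (w := d') (h := 1 - ε) (by linarith)
    (by linarith) (by linarith) (by linarith) (by linarith) (by linarith) (by linarith)
    (by linarith) (by rw [abs_le]; constructor <;> linarith)
    (by rw [abs_le]; constructor <;> linarith)
    (by rw [← orient_rotate a b d, ← orient_rotate a b d', ← orient_rotate b d, ← orient_rotate b d']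
        exact mul_pos h.dab h'.dab)
  linarith [hs hne]

/-- The vertices `a`, `c` of a squarish quadrilateral determine `b`. -/
theorem IsSquarish.second_eq {ε : ℝ} {a b c d b' d' : Plane} (h0 : 0 < ε) (h1 : ε ≤ 1 / 1000)
    (h : IsSquarish ε a b c d) (h' : IsSquarish ε a b' c d')
    (hs : b ≠ b' → 1 - ε ≤ dist b b') : b = b' := by
  by_contra hne
  have D := fun {r} => @sq_mem_of_diag ε r h0 h1
  have I := fun {r} => @sq_mem_of_side ε r h0 h1
  obtain ⟨a1, a2⟩ := D h.ac
  obtain ⟨b1, b2⟩ := I h.ab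
  obtain ⟨c1, c2⟩ := I h.bc
  obtain ⟨b1', b2'⟩ := I h'.ab
  obtain ⟨c1', c2'⟩ := I h'.bc
  rw [dist_comm b c] at c1 c2
  rw [dist_comm b' c] at c1' c2'
  have e1 : orient a c b = -orient a b c := by unfold orient; ring
  have e2 : orient a c b' = -orient a b' c := by unfold orient; ring
  have := dist_lt_of_same_side (p := a) (q := c) (z := b) (w := b') (h := 1 - ε) (by linarith)
    (by linarith) (by linarith) (by linarith) (by linarith) (by linarith) (by linarith)
    (by linarith) (by rw [abs_le]; constructor <;> linarith)
    (by rw [abs_le]; constructor <;> linarith)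
    (by rw [e1, e2, neg_mul_neg]; exact mul_pos h.abc h'.abc)
  linarith [hs hne]

/-- If `p` is joined to the end points `a`, `c` of a diagonal of a squarish quadrilateral and lies
on the same side of it as `b`, then `p = b`. -/
theorem IsSquarish.apex_eq {ε : ℝ} {a b c d p : Plane} (h0 : 0 < ε) (h1 : ε ≤ 1 / 1000)
    (h : IsSquarish ε a b c d) (hpa : 1 - ε ≤ dist a p) (hpa' : dist a p ≤ Real.sqrt 2 + ε)
    (hpc : 1 - ε ≤ dist c p) (hpc' : dist c p ≤ Real.sqrt 2 + ε)
    (ho : 0 < orient a p c) (hs : p ≠ b → 1 - ε ≤ dist p b) : p = b := by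
  by_contra hne
  have D := fun {r} => @sq_mem_of_diag ε r h0 h1
  have I := fun {r} => @sq_mem_of_side ε r h0 h1
  obtain ⟨q1, q2⟩ := sqrt_two_mem
  have hb : ∀ r : ℝ, 1 - ε ≤ r → r ≤ Real.sqrt 2 + ε → 0.998 ≤ r ^ 2 ∧ r ^ 2 ≤ 2.0035 :=
    fun r h2 h3 => ⟨by nlinarith, by nlinarith⟩
  have hab := I h.ab
  have hcb := I h.bc
  rw [dist_comm b c] at hcb
  have hac := D h.ac
  have hap := hb _ hpa hpa'
  have hcp := hb _ hpc hpc'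
  -- The height of a triangle over ac in terms of its sides: the median formula minus the squared
  -- component along ac. The same is done for p, and `e` compares the two apexes.
  have ey : orient a b c ^ 2 = dist a c ^ 2 * ((dist a b ^ 2 + dist c b ^ 2) / 2 -
      dist a c ^ 2 / 4) - ((dist a b ^ 2 - dist c b ^ 2) / 2) ^ 2 := by
    simp only [dist_sq_eq, orient]; ring
  have ex : orient a p c ^ 2 = dist a c ^ 2 * ((dist a p ^ 2 + dist c p ^ 2) / 2 -
      dist a c ^ 2 / 4) - ((dist a p ^ 2 - dist c p ^ 2) / 2) ^ 2 := by
    simp only [dist_sq_eq, orient]; ring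
  have e : dist a c ^ 2 * dist p b ^ 2 = ((dist a p ^ 2 - dist c p ^ 2) / 2 -
      (dist a b ^ 2 - dist c b ^ 2) / 2) ^ 2 + (orient a p c - orient a b c) ^ 2 := by
    simp only [dist_sq_eq, orient]; ring
  have hpb : 0.998 ≤ dist p b ^ 2 := by have := hs hne; nlinarith
  have hy := h.abc
  clear hs hpa hpa' hpc hpc' hb D I h
  set x := orient a p c
  set y := orient a b c
  set L := dist a c ^ 2
  set P := dist p b ^ 2
  obtain ⟨l1, l2⟩ := hac
  obtain ⟨a1, a2⟩ := hab
  obtain ⟨b1, b2⟩ := hcb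
  obtain ⟨c1, c2⟩ := hap
  obtain ⟨d1, d2⟩ := hcp
  set A := dist a b ^ 2
  set B := dist c b ^ 2
  set C := dist a p ^ 2
  set E := dist c p ^ 2
  have y1 : y ^ 2 ≤ 1.15 := by
    have : L * ((A + B) / 2 - L / 4) ≤ 2.05 * (1.04 - 1.95 / 4) := by gcongr <;> linarith
    linarith [sq_nonneg ((A - B) / 2)]
  have y2 : 0.86 ≤ y ^ 2 := by
    have h2 : 1.95 * (0.96 - 2.05 / 4) ≤ L * ((A + B) / 2 - L / 4) := by gcongr; linarith
    have h3 : ((A - B) / 2) ^ 2 ≤ 0.04 ^ 2 := by apply sq_le_sq'  <;> linarith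
    linarith
  have x1 : x ^ 2 ≤ 3.12 := by
    have : L * ((C + E) / 2 - L / 4) ≤ 2.05 * (2.0035 - 1.95 / 4) := by gcongr <;> linarith
    linarith [sq_nonneg ((C - E) / 2)]
  -- With k = |C - E|/2 both squared sides stay above 0.998, so their mean is at least 0.998 + k;
  -- this gain outweighs the loss k².
  have x2 : 0.9 ≤ x ^ 2 := by
    obtain ⟨k, hk0, hk1, hk2, hk3⟩ : ∃ k, 0 ≤ k ∧ k ≤ 1 ∧ ((C - E) / 2) ^ 2 = k ^ 2 ∧
        0.998 + k ≤ (C + E) / 2 := by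
      rcases le_total E C with h | h
      · exact ⟨(C - E) / 2, by linarith, by linarith, rfl, by linarith⟩
      · exact ⟨(E - C) / 2, by linarith, by linarith, by ring, by linarith⟩
    have h2 : 1.95 * (0.998 + k - 2.05 / 4) ≤ L * ((C + E) / 2 - L / 4) := by
      gcongr; linarith
    linarith [mul_nonneg hk0 (sub_nonneg.2 hk1)]
  have y3 : y ≤ 1.08 := by nlinarith only [y1]
  have y4 : 0.92 ≤ y := by nlinarith only [y2, hy]
  have x3 : x ≤ 1.77 := by nlinarith only [x1]
  have x4 : 0.94 ≤ x := by nlinarith only [x2, ho]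
  -- Across and along ac the apexes differ by squares totalling at most 0.86² + 0.55² < 1.05,
  -- whereas separation requires more than 1.9.
  have h4 : (x - y) ^ 2 ≤ 0.86 ^ 2 := by apply sq_le_sq' <;> linarith
  have h5 : ((C - E) / 2 - (A - B) / 2) ^ 2 ≤ 0.55 ^ 2 := by apply sq_le_sq' <;> linarith
  have h6 : 1.95 * 0.998 ≤ L * P := by gcongr
  linarith

/-! ### The bond graph and its maximal non-crossing part -/

/-- Distinct points of `X` have distance at least `δ`. -/
def Separated (δ : ℝ) (X : Finset Plane) : Prop :=
  ∀ x ∈ X, ∀ y ∈ X, x ≠ y → δ ≤ dist x y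

open Classical in
/-- The ordered pairs of distinct points of `X` at distance less than `√2 + ε`. -/
noncomputable def bonds (ε : ℝ) (X : Finset Plane) : Finset (Plane × Plane) :=
  X.offDiag.filter fun e => dist e.1 e.2 < Real.sqrt 2 + ε

theorem mem_bonds {ε : ℝ} {X : Finset Plane} {e : Plane × Plane} :
    e ∈ bonds ε X ↔ e.1 ∈ X ∧ e.2 ∈ X ∧ e.1 ≠ e.2 ∧ dist e.1 e.2 < Real.sqrt 2 + ε := by
  simp [bonds, and_assoc]

theorem swap_mem_bonds {ε : ℝ} {X : Finset Plane} {e : Plane × Plane} (h : e ∈ bonds ε X) :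
    e.swap ∈ bonds ε X := by
  rw [mem_bonds] at *
  exact ⟨h.2.1, h.1, h.2.2.1.symm, by rw [dist_comm]; exact h.2.2.2⟩

/-- A maximal set of bonds no two of which cross. -/
structure IsPlanarPart (ε : ℝ) (X : Finset Plane) (G : Finset (Plane × Plane)) : Prop where
  subset : G ⊆ bonds ε X
  swap_mem : ∀ e ∈ G, e.swap ∈ G
  not_crosses : ∀ e ∈ G, ∀ f ∈ G, ¬Crosses e f
  maximal : ∀ e ∈ bonds ε X, e ∉ G → ∃ f ∈ G, Crosses e f

theorem exists_isPlanarPart (ε : ℝ) (X : Finset Plane) : ∃ G, IsPlanarPart ε X G := by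
  classical
  let F := (bonds ε X).powerset.filter fun G => ∀ e ∈ G, ∀ f ∈ G, ¬Crosses e f
  obtain ⟨G, hG⟩ := F.exists_maximal ⟨∅, by simp [F]⟩
  have hGF : G ⊆ bonds ε X ∧ ∀ e ∈ G, ∀ f ∈ G, ¬Crosses e f := by simpa [F] using hG.1
  have hmax : ∀ e ∈ bonds ε X, e ∉ G → ∃ f ∈ G, Crosses e f := by
    intro e he heG
    by_contra! hne
    refine heG (hG.2 (y := insert e G) ?_ (Finset.subset_insert _ _)
      (Finset.mem_insert_self _ _))
    simp only [F, Finset.mem_filter, Finset.mem_powerset]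
    refine ⟨Finset.insert_subset he hGF.1, fun f hf g hg => ?_⟩
    rw [Finset.mem_insert] at hf hg
    rcases hf with rfl | hf <;> rcases hg with rfl | hg
    · exact not_crosses_self _
    · exact hne g hg
    · exact fun h => hne f hf h.symm
    · exact hGF.2 f hf g hg
  refine ⟨G, hGF.1, fun e he => ?_, hGF.2, hmax⟩
  by_contra h
  obtain ⟨f, hf, hc⟩ := hmax _ (swap_mem_bonds (hGF.1 he)) h
  exact hGF.2 e he f hf (by simpa using hc.swap_left)

theorem IsPlanarPart.exists_squarish {ε : ℝ} {X : Finset Plane} {G : Finset (Plane × Plane)}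
    (hG : IsPlanarPart ε X G) (h0 : 0 < ε) (h1 : ε ≤ 1 / 1000) (hX : Separated (1 - ε) X)
    {e : Plane × Plane} (he : e ∈ bonds ε X) (heG : e ∉ G) :
    ∃ f ∈ G, IsSquarish ε e.1 f.1 e.2 f.2 := by
  obtain ⟨f, hf, hne, hc⟩ := hG.maximal e he heG
  have hf' := mem_bonds.1 (hG.subset hf)
  have he' := mem_bonds.1 he
  rcases isSquarish_of_crossing h0 h1 hc (hX _ hf'.1 _ he'.1 hne.1.symm)
    (hX _ hf'.1 _ he'.2.1 hne.2.2.1.symm) (hX _ hf'.2.1 _ he'.1 hne.2.1.symm)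
    (hX _ hf'.2.1 _ he'.2.1 hne.2.2.2.symm) he'.2.2.2.le hf'.2.2.2.le with h | h
  · exact ⟨f, hf, h⟩
  · exact ⟨f.swap, hG.swap_mem f hf, h⟩

open Classical in
/-- The squarish quadrilaterals given by the bonds outside a planar part use every bond at most
once. -/
theorem IsPlanarPart.mul_card_le {ε : ℝ} {X : Finset Plane} {G : Finset (Plane × Plane)}
    (hG : IsPlanarPart ε X G) (h0 : 0 < ε) (h1 : ε ≤ 1 / 1000) (hX : Separated (1 - ε) X)
    {U : ℝ → ℝ} (hU : ∀ r, 0 < r → 0 ≤ U r) {m : ℝ}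
    (hm : ∀ a b c d : Plane, IsSquarish ε a b c d → m ≤ U (dist a c) + U (dist b d) +
      1 / 2 * (U (dist a b) + U (dist b c) + U (dist c d) + U (dist d a))) :
    m * ((bonds ε X \ G).card : ℝ) ≤ ∑ e ∈ bonds ε X, U (dist e.1 e.2) := by
  set R := bonds ε X \ G with hR
  have hRm : ∀ {e}, e ∈ R ↔ e ∈ bonds ε X ∧ e ∉ G := by simp [hR]
  have hex : ∀ e : Plane × Plane, ∃ f : Plane × Plane,
      e ∈ R → f ∈ G ∧ IsSquarish ε e.1 f.1 e.2 f.2 := by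
    intro e
    by_cases he : e ∈ R
    · obtain ⟨f, hf⟩ := hG.exists_squarish h0 h1 hX (hRm.1 he).1 (hRm.1 he).2
      exact ⟨f, fun _ => hf⟩
    · exact ⟨e, fun h => absurd h he⟩
  choose q hq using hex
  have hqG := fun e he => (hq e he).1
  replace hq := fun e he => (hq e he).2
  have hX1 : ∀ e ∈ R, e.1 ∈ X := fun e he => (mem_bonds.1 (hRm.1 he).1).1
  have hX2 : ∀ e ∈ R, e.2 ∈ X := fun e he => (mem_bonds.1 (hRm.1 he).1).2.1
  have hX3 : ∀ e ∈ R, (q e).1 ∈ X := fun e he => (mem_bonds.1 (hG.subset (hqG e he))).1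
  have hX4 : ∀ e ∈ R, (q e).2 ∈ X := fun e he => (mem_bonds.1 (hG.subset (hqG e he))).2.1
  have hswap : ∀ e ∈ R, e.swap ∈ R := by
    intro e he
    rw [hRm] at *
    exact ⟨swap_mem_bonds he.1, fun h => he.2 (by simpa using hG.swap_mem _ h)⟩
  have hqswap : ∀ e ∈ R, (q e.swap).1 = (q e).2 := by
    intro e he
    exact (hq _ (hswap e he)).second_eq h0 h1 (hq e he).rotate.rotate
      (hX _ (hX3 _ (hswap e he)) _ (hX4 e he))
  -- Only two of the four sides are charged to e; the other two are charged to the reversed bond.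
  -- All sides run counterclockwise, with their near-square on the left.
  let f3 : Plane × Plane → Plane × Plane := fun e => (e.1, (q e).1)
  let f4 : Plane × Plane → Plane × Plane := fun e => ((q e).1, e.2)
  have inj2 : Set.InjOn q R := by
    intro e he e' he' h
    have k1 := hq e he
    have k2 := hq e' he'
    rw [← h] at k2
    exact Prod.ext
      (k1.rotate.rotate.rotate.second_eq h0 h1 k2.rotate.rotate.rotate
        (hX _ (hX1 e he) _ (hX1 e' he')))
      (k1.rotate.second_eq h0 h1 k2.rotate (hX _ (hX2 e he) _ (hX2 e' he')))
  have inj3 : Set.InjOn f3 R := by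
    intro e he e' he' h
    have k1 := hq e he
    have k2 := hq e' he'
    obtain ⟨h, h'⟩ := Prod.ext_iff.1 h
    simp only [f3] at h h'
    rw [← h, ← h'] at k2
    exact Prod.ext h (k1.third_eq h0 h1 k2 (hX _ (hX2 e he) _ (hX2 e' he')))
  have inj4 : Set.InjOn f4 R := by
    intro e he e' he' h
    have k1 := hq e he
    have k2 := hq e' he'
    obtain ⟨h, h'⟩ := Prod.ext_iff.1 h
    simp only [f4] at h h'
    rw [← h, ← h'] at k2
    exact Prod.ext (k1.rotate.fourth_eq h0 h1 k2.rotate (hX _ (hX1 e he) _ (hX1 e' he'))) h'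
  obtain ⟨r1, r2⟩ := sqrt_two_mem
  have side_bond : ∀ {x y}, x ∈ X → y ∈ X → dist x y ∈ sideRange (16 * ε) →
      (x, y) ∈ bonds ε X ∧ dist x y < 1.1 := by
    intro x y hx hy h
    obtain ⟨h2, h3⟩ := h
    refine ⟨mem_bonds.2 ⟨hx, hy, ?_, by simp only; linarith⟩, by linarith⟩
    simp only
    rintro rfl
    rw [dist_self] at h2; linarith
  have s3 : ∀ e ∈ R, f3 e ∈ bonds ε X ∧ dist (f3 e).1 (f3 e).2 < 1.1 := fun e he =>
    side_bond (hX1 e he) (hX3 e he) (hq e he).ab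
  have s4 : ∀ e ∈ R, f4 e ∈ bonds ε X ∧ dist (f4 e).1 (f4 e).2 < 1.1 := fun e he =>
    side_bond (hX3 e he) (hX2 e he) (hq e he).bc
  have d1 : ∀ e ∈ R, 1.2 < dist e.1 e.2 := fun e he => by
    have := (hq e he).ac.1; linarith
  have d2 : ∀ e ∈ R, 1.2 < dist (q e).1 (q e).2 := fun e he => by
    have := (hq e he).bd.1; linarith
  have D12 : Disjoint R (R.image q) := by
    rw [Finset.disjoint_left]
    intro e he h
    obtain ⟨e', he', rfl⟩ := Finset.mem_image.1 h
    exact (hRm.1 he).2 (hqG e' he')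
  -- A common oriented side would have the same near-square on its left in both cases, making e both
  -- a bond outside G and the chosen crossing bond in G.
  have D34 : Disjoint (R.image f3) (R.image f4) := by
    rw [Finset.disjoint_left]
    intro e h h'
    obtain ⟨e, he, rfl⟩ := Finset.mem_image.1 h
    obtain ⟨e', he', h⟩ := Finset.mem_image.1 h'
    obtain ⟨h, h'⟩ := Prod.ext_iff.1 h
    simp only [f3, f4] at h h'
    have k1 := hq e he
    have k2 := (hq e' he').rotate
    rw [h, h'] at k2
    have := k1.third_eq h0 h1 k2 (hX _ (hX2 e he) _ (hX4 e' he'))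
    refine (hRm.1 he).2 ?_
    have := hqG e' he'
    rwa [show q e' = e from Prod.ext h (by symm; assumption)] at this
  have Dall : Disjoint (R ∪ R.image q) (R.image f3 ∪ R.image f4) := by
    have hlong : ∀ e ∈ R ∪ R.image q, 1.2 < dist e.1 e.2 := by
      intro e he
      rcases Finset.mem_union.1 he with he | he
      · exact d1 e he
      · obtain ⟨e, he2, rfl⟩ := Finset.mem_image.1 he
        exact d2 e he2
    have hshort : ∀ e ∈ R.image f3 ∪ R.image f4, dist e.1 e.2 < 1.1 := by
      intro e he
      rcases Finset.mem_union.1 he with he | he <;>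
        obtain ⟨e, he2, rfl⟩ := Finset.mem_image.1 he
      · exact (s3 e he2).2
      · exact (s4 e he2).2
    rw [Finset.disjoint_left]
    intro e he he'
    linarith [hlong e he, hshort e he']
  have hsub : (R ∪ R.image q) ∪ (R.image f3 ∪ R.image f4) ⊆ bonds ε X := by
    refine Finset.union_subset (Finset.union_subset Finset.sdiff_subset ?_)
      (Finset.union_subset ?_ ?_) <;> rw [Finset.image_subset_iff] <;> intro e he
    · exact hG.subset (hqG e he)
    · exact (s3 e he).1
    · exact (s4 e he).1
  have hle := Finset.sum_le_sum_of_subset_of_nonneg (f := fun e => U (dist e.1 e.2)) hsub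
    (fun e he _ => hU _ (dist_pos.2 (mem_bonds.1 he).2.2.1))
  rw [Finset.sum_union Dall, Finset.sum_union D12, Finset.sum_union D34, Finset.sum_image inj2,
    Finset.sum_image inj3, Finset.sum_image inj4] at hle
  -- Reversing e exchanges the two pairs of sides, so averaging gives all four sides weight 1/2.
  have hsym : ∑ e ∈ R, (U (dist (f3 e).1 (f3 e).2) + U (dist (f4 e).1 (f4 e).2)) =
      ∑ e ∈ R, (U (dist e.2 (q e).2) + U (dist (q e).2 e.1)) := by
    refine Finset.sum_nbij' Prod.swap Prod.swap hswap hswap (by simp) (by simp) ?_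
    intro e he
    have := hqswap _ (hswap e he)
    rw [Prod.swap_swap] at this
    simp only [f3, f4, Prod.fst_swap, Prod.snd_swap, ← this]
  rw [Finset.sum_add_distrib] at hsym
  refine le_trans ?_ hle
  rw [mul_comm, ← nsmul_eq_mul, ← Finset.sum_const]
  refine (Finset.sum_le_sum fun e he => hm _ _ _ _ (hq e he)).trans (le_of_eq ?_)
  have : ∀ e ∈ R, U (dist e.1 e.2) + U (dist (q e).1 (q e).2) +
      1 / 2 * (U (dist e.1 (q e).1) + U (dist (q e).1 e.2) + U (dist e.2 (q e).2) +
        U (dist (q e).2 e.1)) = U (dist e.1 e.2) + U (dist (q e).1 (q e).2) +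
      (1 / 2 * U (dist (f3 e).1 (f3 e).2) + 1 / 2 * U (dist (f4 e).1 (f4 e).2)) +
      1 / 2 * (U (dist e.2 (q e).2) + U (dist (q e).2 e.1)) := by
    intro e _; simp only [f3, f4]; ring
  rw [Finset.sum_congr rfl this]
  simp only [Finset.sum_add_distrib, ← Finset.mul_sum] at hsym ⊢
  linarith

/-! ### Angles around a vertex and the planar bound -/

/-- Successive intervals inside [l, B] have total length at most B - l: remove the one starting
furthest right and replace B by its left end. -/
theorem sum_le_of_gaps {ι : Type*} [DecidableEq ι] (S : Finset ι) (θ A : ι → ℝ) (l : ℝ) :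
    ∀ B : ℝ, l ≤ B → (∀ i ∈ S, l ≤ θ i) → (∀ i ∈ S, θ i + A i ≤ B) →
      (∀ i ∈ S, ∀ j ∈ S, i ≠ j → θ i ≤ θ j → θ i + A i ≤ θ j) → ∑ i ∈ S, A i ≤ B - l := by
  induction S using Finset.induction_on_max_value θ with
  | empty => intro B h _ _ _; simpa using h
  | insert a s ha hmax ih =>
    intro B hlB hl hB h
    rw [Finset.sum_insert ha]
    have := ih (θ a) (hl a (by simp)) (fun i hi => hl i (by simp [hi]))
      (fun i hi => h i (by simp [hi]) a (by simp) (by rintro rfl; exact ha hi) (hmax i hi))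
      (fun i hi j hj => h i (by simp [hi]) j (by simp [hj]))
    linarith [hB a (by simp)]

/-- Disjoint arcs of the circle have total length at most `2π`. -/
theorem sum_le_two_pi {ι : Type*} [DecidableEq ι] (S : Finset ι) (θ A : ι → ℝ)
    (hA : ∀ i ∈ S, A i ≤ 2 * Real.pi)
    (h : ∀ i ∈ S, ∀ j ∈ S, i ≠ j → θ i ≤ θ j → θ i + A i ≤ θ j)
    (h' : ∀ i ∈ S, ∀ j ∈ S, θ j < θ i → θ i + A i ≤ θ j + 2 * Real.pi) :
    ∑ i ∈ S, A i ≤ 2 * Real.pi := by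
  rcases S.eq_empty_or_nonempty with rfl | hS
  · simpa using Real.pi_pos.le
  obtain ⟨m, hm, hmin⟩ := S.exists_min_image θ hS
  have := sum_le_of_gaps S θ A (θ m) (θ m + 2 * Real.pi) (by linarith [Real.pi_pos]) hmin ?_ h
  · linarith
  · intro i hi
    rcases (hmin i hi).eq_or_lt with e | e
    · rw [e]; linarith [hA i hi]
    · exact h' i hi m hm e

/-- The direction of `y` as seen from `p`. -/
noncomputable def direction (p y : Plane) : ℝ :=
  Complex.arg ⟨y 0 - p 0, y 1 - p 1⟩

theorem norm_eq_dist (p y : Plane) : ‖(⟨y 0 - p 0, y 1 - p 1⟩ : ℂ)‖ = dist p y := by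
  rw [← sq_eq_sq₀ (norm_nonneg _) dist_nonneg, dist_sq_eq, ← Complex.normSq_eq_norm_sq,
    Complex.normSq_apply]
  ring

theorem dist_mul_cos_direction (p y : Plane) :
    dist p y * Real.cos (direction p y) = y 0 - p 0 := by
  rw [← norm_eq_dist, direction, Complex.norm_mul_cos_arg]

theorem dist_mul_sin_direction (p y : Plane) :
    dist p y * Real.sin (direction p y) = y 1 - p 1 := by
  rw [← norm_eq_dist, direction, Complex.norm_mul_sin_arg]

theorem orient_eq_mul_sin (p y w : Plane) :
    orient p y w = dist p y * dist p w * Real.sin (direction p w - direction p y) := by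
  rw [orient, ← dist_mul_cos_direction p y, ← dist_mul_cos_direction p w,
    ← dist_mul_sin_direction p y, ← dist_mul_sin_direction p w, Real.sin_sub]
  ring

theorem dotAt_eq_mul_cos (p y w : Plane) :
    dotAt p y w = dist p y * dist p w * Real.cos (direction p w - direction p y) := by
  rw [dotAt, ← dist_mul_cos_direction p y, ← dist_mul_cos_direction p w,
    ← dist_mul_sin_direction p y, ← dist_mul_sin_direction p w, Real.cos_sub]
  ring

open EuclideanGeometry in
theorem dotAt_eq_mul_cos_angle (p y w : Plane) :
    dotAt p y w = dist p y * dist p w * Real.cos (∠ y p w) := by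
  have := InnerProductGeometry.cos_angle_mul_norm_mul_norm (y -ᵥ p) (w -ᵥ p)
  rw [← dist_eq_norm_vsub', ← dist_eq_norm_vsub'] at this
  rw [EuclideanGeometry.angle, mul_comm, this]
  simp only [dotAt, vsub_eq_sub, PiLp.inner_apply, Fin.sum_univ_two, PiLp.sub_apply,
    RCLike.inner_apply, conj_trivial]
  ring

open EuclideanGeometry in
theorem orient_eq_mul_sin_angle {p y w : Plane} (h : 0 ≤ orient p y w) :
    orient p y w = dist p y * dist p w * Real.sin (∠ y p w) := by
  have hs : 0 ≤ Real.sin (∠ y p w) :=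
    Real.sin_nonneg_of_nonneg_of_le_pi (angle_nonneg _ _ _) (angle_le_pi _ _ _)
  rw [← sq_eq_sq₀ h (by positivity), orient_sq, dotAt_eq_mul_cos_angle, mul_pow, mul_pow (_ * _), Real.sin_sq]
  ring

theorem bond_sq_mem {ε r : ℝ} (h0 : 0 < ε) (h1 : ε ≤ 1 / 1000) (h2 : 1 - ε ≤ r)
    (h3 : r ≤ Real.sqrt 2 + ε) : 0.998 ≤ r ^ 2 ∧ r ^ 2 ≤ 2.0035 := by
  obtain ⟨q1, q2⟩ := sqrt_two_mem
  exact ⟨by nlinarith, by nlinarith⟩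

/-- On a common ray the distance of y and w is the difference of their distances from p, at most
1/2, which violates separation. -/
theorem eq_of_same_direction {ε : ℝ} {p y w : Plane} (h0 : 0 < ε) (h1 : ε ≤ 1 / 1000)
    (hy : 1 - ε ≤ dist p y) (hy' : dist p y ≤ Real.sqrt 2 + ε)
    (hw : 1 - ε ≤ dist p w) (hw' : dist p w ≤ Real.sqrt 2 + ε)
    (hyw : y ≠ w → 1 - ε ≤ dist y w) (ho : orient p y w = 0) (hd : 0 < dotAt p y w) : y = w := by
  by_contra hne
  have h2 := hyw hne
  obtain ⟨q1, q2⟩ := sqrt_two_mem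
  have e := orient_sq p y w
  have e2 := dotAt_eq p y w
  have e3 : dotAt p y w = dist p y * dist p w := by
    rw [← sq_eq_sq₀ hd.le (by positivity)]
    rw [ho] at e
    linarith
  have e4 : dist y w ^ 2 = (dist p y - dist p w) ^ 2 := by linarith
  have e5 : (dist p y - dist p w) ^ 2 ≤ 0.5 ^ 2 := by apply sq_le_sq' <;> linarith
  nlinarith

section planar

variable {ε : ℝ} {X : Finset Plane} {G : Finset (Plane × Plane)}

theorem IsPlanarPart.bounds (hG : IsPlanarPart ε X G) (hX : Separated (1 - ε) X) {x y : Plane}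
    (h : (x, y) ∈ G) :
    x ∈ X ∧ y ∈ X ∧ x ≠ y ∧ 1 - ε ≤ dist x y ∧ dist x y < Real.sqrt 2 + ε := by
  obtain ⟨h2, h3, h4, h5⟩ := mem_bonds.1 (hG.subset h)
  exact ⟨h2, h3, h4, hX _ h2 _ h3 h4, h5⟩

/-- No bond of a planar part starts at a vertex of a triangle of bonds and leads into it. -/
theorem IsPlanarPart.not_mem_wedge (hG : IsPlanarPart ε X G) (h0 : 0 < ε) (h1 : ε ≤ 1 / 1000)
    (hX : Separated (1 - ε) X) {p y z w : Plane} (hpy : (p, y) ∈ G) (hpz : (p, z) ∈ G)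
    (hyz : (y, z) ∈ G) (hpw : (p, w) ∈ G) (ho : 0 < orient p y z) (hyw : 0 < orient p y w)
    (hwz : 0 < orient p w z) : False := by
  obtain ⟨Xp, Xy, npy, ly, uy⟩ := hG.bounds hX hpy
  obtain ⟨-, Xz, npz, lz, uz⟩ := hG.bounds hX hpz
  obtain ⟨-, -, nyz, lyz, uyz⟩ := hG.bounds hX hyz
  obtain ⟨-, Xw, npw, lw, uw⟩ := hG.bounds hX hpw
  have nwy : w ≠ y := by
    rintro rfl
    have : orient p w w = 0 := by unfold orient; ring
    linarith
  have nwz : w ≠ z := by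
    rintro rfl
    have : orient p w w = 0 := by unfold orient; ring
    linarith
  set O := orient p y z with hO
  set β := orient p w z / O with hβ
  set γ := orient p y w / O with hγ
  have β0 : 0 < β := div_pos hwz ho
  have γ0 : 0 < γ := div_pos hyw ho
  have eβ : β * O = orient p w z := div_mul_cancel₀ _ ho.ne'
  have eγ : γ * O = orient p y w := div_mul_cancel₀ _ ho.ne'
  have ew0 : w 0 - p 0 = β * (y 0 - p 0) + γ * (z 0 - p 0) := by
    have : (w 0 - p 0) * O = (β * (y 0 - p 0) + γ * (z 0 - p 0)) * O := by
      calc _ = (β * O) * (y 0 - p 0) + (γ * O) * (z 0 - p 0) := by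
            rw [eβ, eγ, hO]; unfold orient; ring
        _ = _ := by ring
    exact mul_right_cancel₀ ho.ne' this
  have ew1 : w 1 - p 1 = β * (y 1 - p 1) + γ * (z 1 - p 1) := by
    have : (w 1 - p 1) * O = (β * (y 1 - p 1) + γ * (z 1 - p 1)) * O := by
      calc _ = (β * O) * (y 1 - p 1) + (γ * O) * (z 1 - p 1) := by
            rw [eβ, eγ, hO]; unfold orient; ring
        _ = _ := by ring
    exact mul_right_cancel₀ ho.ne' this
  -- Either w lies in the triangle, too close to a vertex for separation, or the segment pw leaves
  -- it through yz, giving a crossing in G.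
  rcases le_or_gt (β + γ) 1 with h | h
  · have B := fun r => @bond_sq_mem ε r h0 h1
    have b1 := B _ ly uy.le
    have b2 := B _ lz uz.le
    have b3 := B _ lyz uyz.le
    have b4 := B _ lw uw.le
    have b5 : 0.998 ≤ dist w y ^ 2 := by
      have := hX _ Xw _ Xy nwy; nlinarith
    have b6 : 0.998 ≤ dist w z ^ 2 := by
      have := hX _ Xw _ Xz nwz; nlinarith
    refine sum_smul_ne_of_far (t := (Finset.univ : Finset (Fin 3))) (by simp)
      (w := ![1 - β - γ, β, γ]) (x := ![p, y, z]) (p := w) ?_ ?_ ?_ ?_ ?_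
    · intro i _
      fin_cases i
      · simp; linarith
      · simpa using β0.le
      · simpa using γ0.le
    · simp only [Fin.sum_univ_three, Matrix.cons_val]; ring
    · intro i _
      fin_cases i
      · simp [dist_comm w p]; linarith
      · simp; linarith
      · simp; linarith
    · intro i _ j _
      fin_cases i <;> fin_cases j <;> simp [dist_comm y p, dist_comm z p, dist_comm z y] <;>
        linarith
    · apply plane_ext
      · simp [Fin.sum_univ_three]; linarith
      · simp [Fin.sum_univ_three]; linarith
  · have hs : 0 < β + γ := by linarith
    refine hG.not_crosses _ hpw _ hyz ⟨⟨npy, npz, nwy, nwz⟩, AffineMap.lineMap p w (1 / (β + γ)),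
      ?_, ?_⟩
    · rw [segment_eq_image_lineMap]
      exact ⟨_, ⟨by positivity, by rw [div_le_one hs]; exact h.le⟩, rfl⟩
    · refine ⟨β / (β + γ), γ / (β + γ), by positivity, by positivity, by field_simp, ?_⟩
      apply plane_ext
      · simp only [AffineMap.lineMap_apply, vsub_eq_sub, vadd_eq_add, PiLp.add_apply,
          PiLp.smul_apply, PiLp.sub_apply, smul_eq_mul, ew0]
        field_simp; ring
      · simp only [AffineMap.lineMap_apply, vsub_eq_sub, vadd_eq_add, PiLp.add_apply,
          PiLp.smul_apply, PiLp.sub_apply, smul_eq_mul, ew1]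
        field_simp; ring

/-- The bond `e` has the triangle with third vertex `z` on its left. -/
def IsLeftTriangle (G : Finset (Plane × Plane)) (e : Plane × Plane) (z : Plane) : Prop :=
  e ∈ G ∧ (e.1, z) ∈ G ∧ (e.2, z) ∈ G ∧ 0 < orient e.1 e.2 z

theorem IsLeftTriangle.rotate (hG : IsPlanarPart ε X G) {e : Plane × Plane} {z : Plane}
    (h : IsLeftTriangle G e z) : IsLeftTriangle G (e.2, z) e.1 :=
  ⟨h.2.2.1, hG.swap_mem _ h.1, hG.swap_mem _ h.2.1, by rw [orient_rotate]; exact h.2.2.2⟩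

/-- Neither third vertex can lie strictly inside the wedge of the other triangle, so both lie in the
same direction from p. -/
theorem IsLeftTriangle.unique (hG : IsPlanarPart ε X G) (h0 : 0 < ε) (h1 : ε ≤ 1 / 1000)
    (hX : Separated (1 - ε) X) {e : Plane × Plane} {z z' : Plane} (h : IsLeftTriangle G e z)
    (h' : IsLeftTriangle G e z') : z = z' := by
  obtain ⟨p, y⟩ := e
  obtain ⟨hpy, hpz, hyz, ho⟩ := h
  obtain ⟨-, hpz', hyz', ho'⟩ := h'
  simp only at *
  have k1 : orient p z z' ≤ 0 := by
    by_contra h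
    exact hG.not_mem_wedge h0 h1 hX hpy hpz' hyz' hpz ho' ho (not_le.1 h)
  have k2 : orient p z' z ≤ 0 := by
    by_contra h
    exact hG.not_mem_wedge h0 h1 hX hpy hpz hyz hpz' ho ho' (not_le.1 h)
  have e1 : orient p z' z = -orient p z z' := by unfold orient; ring
  have e0 : orient p z z' = 0 := by linarith
  obtain ⟨Xp, Xy, npy, ly, uy⟩ := hG.bounds hX hpy
  obtain ⟨-, Xz, npz, lz, uz⟩ := hG.bounds hX hpz
  obtain ⟨-, Xz', npz', lz', uz'⟩ := hG.bounds hX hpz'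
  refine eq_of_same_direction h0 h1 lz uz.le lz' uz'.le (hX _ Xz _ Xz') e0 ?_
  have key : dotAt p z z' * orient p y z ^ 2 = dist p z ^ 2 * (orient p y z * orient p y z') -
      dotAt p y z * orient p y z * orient p z z' := by
    simp only [dist_sq_eq, dotAt, orient]; ring
  rw [e0, mul_zero, sub_zero] at key
  have : 0 < dist p z ^ 2 * (orient p y z * orient p y z') := by
    have := dist_pos.2 npz; positivity
  rw [← key] at this
  exact pos_of_mul_pos_left this (sq_nonneg _)

end planar

section planar

variable {ε : ℝ} {X : Finset Plane} {G : Finset (Plane × Plane)}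

open Classical in
open EuclideanGeometry in
/-- The angle at `e.1` of the triangle to the left of the bond `e`, or `π / 3` if there is no such
triangle. -/
noncomputable def wedge (G : Finset (Plane × Plane)) (e : Plane × Plane) : ℝ :=
  if h : ∃ z, IsLeftTriangle G e z then ∠ e.2 e.1 h.choose else Real.pi / 3

open EuclideanGeometry in
theorem IsLeftTriangle.wedge_eq (hG : IsPlanarPart ε X G) (h0 : 0 < ε) (h1 : ε ≤ 1 / 1000)
    (hX : Separated (1 - ε) X) {e : Plane × Plane} {z : Plane} (h : IsLeftTriangle G e z) :
    wedge G e = ∠ e.2 e.1 z := by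
  have hex : ∃ z, IsLeftTriangle G e z := ⟨z, h⟩
  rw [wedge, dif_pos hex, hex.choose_spec.unique hG h0 h1 hX h]

theorem wedge_le_pi (G : Finset (Plane × Plane)) (e : Plane × Plane) : wedge G e ≤ Real.pi := by
  unfold wedge
  split_ifs
  · exact EuclideanGeometry.angle_le_pi _ _ _
  · linarith [Real.pi_pos]

/-- The angle δ from y counterclockwise to w is given by sine and cosine, so it may exceed π. If it
were smaller than the wedge, a triangle on the left would be entered by pw; with no triangle, an
angle below π/3 would create one. -/
theorem IsPlanarPart.not_lt_wedge (hG : IsPlanarPart ε X G) (h0 : 0 < ε) (h1 : ε ≤ 1 / 1000)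
    (hX : Separated (1 - ε) X) {p y w : Plane} (hpy : (p, y) ∈ G) (hpw : (p, w) ∈ G)
    (hne : y ≠ w) {δ : ℝ} (hδ : 0 ≤ δ)
    (hs : orient p y w = dist p y * dist p w * Real.sin δ)
    (hc : dotAt p y w = dist p y * dist p w * Real.cos δ) : wedge G (p, y) ≤ δ := by
  by_contra hlt
  push Not at hlt
  obtain ⟨Xp, Xy, npy, ly, uy⟩ := hG.bounds hX hpy
  obtain ⟨-, Xw, npw, lw, uw⟩ := hG.bounds hX hpw
  have py := dist_pos.2 npy
  have pw := dist_pos.2 npw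
  rcases hδ.eq_or_lt with rfl | hδ
  · refine hne (eq_of_same_direction h0 h1 ly uy.le lw uw.le (hX _ Xy _ Xw) (by simp [hs]) ?_)
    rw [hc, Real.cos_zero]; positivity
  have hπ := hlt.trans_le (wedge_le_pi G _)
  have ho : 0 < orient p y w := by
    rw [hs]; have := Real.sin_pos_of_pos_of_lt_pi hδ hπ; positivity
  by_cases hT : ∃ z, IsLeftTriangle G (p, y) z
  · obtain ⟨z, hz⟩ := hT
    rw [hz.wedge_eq hG h0 h1 hX] at hlt
    obtain ⟨-, hpz, hyz, hoz⟩ := hz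
    simp only at *
    refine hG.not_mem_wedge h0 h1 hX hpy hpz hyz hpw hoz ho ?_
    have pz := dist_pos.2 (hG.bounds hX hpz).2.2.1
    have key : orient p w z * dist p y ^ 2 =
        dotAt p y w * orient p y z - orient p y w * dotAt p y z := by
      simp only [dist_sq_eq, dotAt, orient]; ring
    rw [hs, hc, dotAt_eq_mul_cos_angle p y z, orient_eq_mul_sin_angle hoz.le] at key
    have hsin := Real.sin_pos_of_pos_of_lt_pi (sub_pos.2 hlt)
      (by linarith [EuclideanGeometry.angle_le_pi y p z])
    rw [Real.sin_sub] at hsin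
    have : 0 < orient p w z * dist p y ^ 2 := by
      rw [key]
      have := mul_pos (mul_pos (pow_pos py 2) (mul_pos pw pz)) hsin
      linarith
    exact pos_of_mul_pos_left this (sq_nonneg _)
  · have hlt3 : δ < Real.pi / 3 := by rwa [wedge, dif_neg hT] at hlt
    have hcos : 1 / 2 < Real.cos δ := by
      rw [← Real.cos_pi_div_three]
      exact Real.cos_lt_cos_of_nonneg_of_le_pi hδ.le (by linarith [Real.pi_pos]) hlt3
    -- Law of cosines with cosine above 1/2: |yw|² < a² + b² - ab ≤ max(a, b)².
    have hd : dist y w ^ 2 < (Real.sqrt 2 + ε) ^ 2 := by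
      have e := dotAt_eq p y w
      rw [hc] at e
      have h2 : dist p y * dist p w * (1 / 2) < dist p y * dist p w * Real.cos δ := by gcongr
      rcases le_total (dist p y) (dist p w) with h | h
      · have := mul_le_mul_of_nonneg_left h py.le
        have := pow_le_pow_left₀ pw.le uw.le 2
        nlinarith
      · have := mul_le_mul_of_nonneg_left h pw.le
        have := pow_le_pow_left₀ py.le uy.le 2
        nlinarith
    have hyw : (y, w) ∈ bonds ε X :=
      mem_bonds.2 ⟨Xy, Xw, hne, lt_of_pow_lt_pow_left₀ 2 (by positivity) hd⟩
    by_cases hywG : (y, w) ∈ G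
    · exact hT ⟨w, hpy, hpw, hywG, ho⟩
    -- If yw is not in G, it is a diagonal of a near-square whose other diagonal f lies in G.
    -- Rigidity identifies p as an end of f, and the other end of f is the third vertex of a left
    -- triangle.
    · obtain ⟨f, hf, hq⟩ := hG.exists_squarish h0 h1 hX hyw hywG
      obtain ⟨Xf1, Xf2, -, -, -⟩ := hG.bounds hX hf
      simp only at hq
      have hq' := hq.rotate.rotate
      have e : p = f.2 := hq'.apex_eq h0 h1 (by rwa [dist_comm]) (by rw [dist_comm]; exact uw.le)
        (by rwa [dist_comm]) (by rw [dist_comm]; exact uy.le)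
        (by rw [orient_rotate, orient_rotate]; exact ho)
        (hX _ Xp _ Xf2)
      rw [← e] at hq
      have hpf : (p, f.1) ∈ G := by
        rw [e]; exact hG.swap_mem _ hf
      have hyf : (y, f.1) ∈ bonds ε X := by
        have := hq.ab
        obtain ⟨q1, q2⟩ := sqrt_two_mem
        refine mem_bonds.2 ⟨Xy, Xf1, ?_, ?_⟩
        · intro h
          simp only at h
          rw [h, dist_self] at this
          linarith [this.1]
        · linarith [this.2]
      refine hT ⟨f.1, hpy, hpf, ?_, hq.dab⟩
      -- A bond outside G is a diagonal, of length near √2, whereas this side has length near 1.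
      by_contra hyfG
      obtain ⟨g, hg, hq2⟩ := hG.exists_squarish h0 h1 hX hyf hyfG
      obtain ⟨q1, q2⟩ := sqrt_two_mem
      have := hq.ab.2
      have := hq2.ac.1
      simp only at this
      linarith

open Classical in
/-- A set of non-crossing bonds of `N` points has at most `3 N` elements (each bond counts twice,
once for each direction). -/
theorem IsPlanarPart.card_le (hG : IsPlanarPart ε X G) (h0 : 0 < ε) (h1 : ε ≤ 1 / 1000)
    (hX : Separated (1 - ε) X) : (G.card : ℝ) ≤ 6 * X.card := by
  have hπ := Real.pi_pos
  have hupper : ∑ e ∈ G, wedge G e ≤ 2 * Real.pi * X.card := by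
    rw [← Finset.sum_fiberwise_of_maps_to (g := Prod.fst) (t := X)
      (fun e he => (mem_bonds.1 (hG.subset he)).1), mul_comm, ← nsmul_eq_mul, ← Finset.sum_const]
    refine Finset.sum_le_sum fun p _ => ?_
    refine sum_le_two_pi _ (fun e => direction p e.2) _
      (fun e _ => (wedge_le_pi G e).trans (by linarith)) ?_ ?_
    · rintro ⟨p', y⟩ he ⟨p'', w⟩ hf hne hle
      obtain ⟨heG, rfl⟩ := Finset.mem_filter.1 he
      obtain ⟨hfG, h⟩ := Finset.mem_filter.1 hf
      obtain rfl : p'' = p' := h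
      clear he hf
      simp only at *
      have := hG.not_lt_wedge h0 h1 hX heG hfG (fun h => hne (by rw [h]))
        (sub_nonneg.2 hle) (orient_eq_mul_sin _ _ _) (dotAt_eq_mul_cos _ _ _)
      linarith
    · rintro ⟨p', y⟩ he ⟨p'', w⟩ hf hlt
      obtain ⟨heG, rfl⟩ := Finset.mem_filter.1 he
      obtain ⟨hfG, h⟩ := Finset.mem_filter.1 hf
      obtain rfl : p'' = p' := h
      clear he hf
      simp only at *
      -- Here w has the smaller argument, so the counterclockwise turn from y to w passes the branch
      -- cut and gains 2π.
      have := hG.not_lt_wedge h0 h1 hX heG hfG (fun h => by rw [h] at hlt; exact lt_irrefl _ hlt)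
        (δ := direction p'' w - direction p'' y + 2 * Real.pi)
        (by
          have h2 : -Real.pi < direction p'' w := Complex.neg_pi_lt_arg _
          have h3 : direction p'' y ≤ Real.pi := Complex.arg_le_pi _
          linarith)
        (by rw [Real.sin_add_two_pi]; exact orient_eq_mul_sin _ _ _)
        (by rw [Real.cos_add_two_pi]; exact dotAt_eq_mul_cos _ _ _)
      linarith
  set T := G.filter fun e => ∃ z, IsLeftTriangle G e z with hT
  have hex : ∀ e, ∃ z, e ∈ T → IsLeftTriangle G e z := by
    intro e
    by_cases he : e ∈ T
    · obtain ⟨z, hz⟩ := (Finset.mem_filter.1 he).2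
      exact ⟨z, fun _ => hz⟩
    · exact ⟨e.1, fun h => absurd h he⟩
  choose t ht using hex
  -- The rotation of order three on the oriented sides of a triangle; summing over its orbits
  -- spreads the angle sum π equally.
  let φ : Plane × Plane → Plane × Plane := fun e => (e.2, t e)
  have hφ : ∀ e ∈ T, φ e ∈ T := fun e he =>
    Finset.mem_filter.2 ⟨(ht e he).2.2.1, e.1, (ht e he).rotate hG⟩
  have htφ : ∀ e ∈ T, t (φ e) = e.1 := fun e he =>
    (ht _ (hφ e he)).unique hG h0 h1 hX ((ht e he).rotate hG)
  have hφ3 : ∀ e ∈ T, φ (φ (φ e)) = e := by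
    intro e he
    refine Prod.ext (htφ e he) ?_
    exact htφ _ (hφ e he)
  have hsum1 : ∑ e ∈ T, wedge G e = ∑ e ∈ T, wedge G (φ e) :=
    Finset.sum_nbij' (fun e => φ (φ e)) φ (fun e he => hφ _ (hφ e he)) hφ hφ3 hφ3
      (fun e he => by rw [hφ3 e he])
  have hsum2 : ∑ e ∈ T, wedge G e = ∑ e ∈ T, wedge G (φ (φ e)) :=
    Finset.sum_nbij' φ (fun e => φ (φ e)) hφ (fun e he => hφ _ (hφ e he)) hφ3 hφ3
      (fun e he => by rw [hφ3 e he])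
  have htri : ∀ e ∈ T, wedge G e + wedge G (φ e) + wedge G (φ (φ e)) = Real.pi := by
    intro e he
    rw [(ht e he).wedge_eq hG h0 h1 hX, ((ht e he).rotate hG).wedge_eq hG h0 h1 hX,
      (((ht e he).rotate hG).rotate hG |> fun h => (show IsLeftTriangle G (φ (φ e)) e.2 by
        simpa only [φ, htφ e he] using h)).wedge_eq hG h0 h1 hX]
    have hne := (hG.bounds hX (ht e he).1).2.2.1
    have := EuclideanGeometry.angle_add_angle_add_angle_eq_pi (t e) hne.symm
    simp only [φ, htφ e he]
    rw [EuclideanGeometry.angle_comm e.2 e.1, EuclideanGeometry.angle_comm (t e) e.2,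
      EuclideanGeometry.angle_comm e.1 (t e)]
    linarith
  have hTsum : ∑ e ∈ T, wedge G e = T.card * (Real.pi / 3) := by
    have := Finset.sum_congr rfl htri
    rw [Finset.sum_add_distrib, Finset.sum_add_distrib, ← hsum1, ← hsum2, Finset.sum_const,
      nsmul_eq_mul] at this
    linarith
  have hCsum : ∑ e ∈ G.filter (fun e => ¬∃ z, IsLeftTriangle G e z), wedge G e =
      (G.filter (fun e => ¬∃ z, IsLeftTriangle G e z)).card * (Real.pi / 3) := by
    rw [← nsmul_eq_mul, ← Finset.sum_const]
    exact Finset.sum_congr rfl fun e he => by rw [wedge, dif_neg (Finset.mem_filter.1 he).2]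
  rw [← Finset.sum_filter_add_sum_filter_not G (fun e => ∃ z, IsLeftTriangle G e z), hTsum, hCsum,
    ← add_mul, ← Nat.cast_add, Finset.card_filter_add_card_filter_not] at hupper
  by_contra h
  push Not at h
  have := mul_lt_mul_of_pos_right h hπ
  linarith

open Classical in
/-- The lower energy bound for separated configurations. -/
theorem sum_bonds_ge (h0 : 0 < ε) (h1 : ε ≤ 1 / 1000) (hX : Separated (1 - ε) X)
    {V : ℝ → ℝ} (hV : ∀ r, 0 < r → -1 ≤ V r) {m : ℝ} (hm4 : -4 ≤ m) (hm3 : m ≤ -3)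
    (hm : ∀ a b c d : Plane, IsSquarish ε a b c d → m ≤ V (dist a c) + V (dist b d) +
      1 / 2 * (V (dist a b) + V (dist b c) + V (dist c d) + V (dist d a))) :
    2 * (X.card * m) ≤ ∑ e ∈ bonds ε X, V (dist e.1 e.2) := by
  obtain ⟨G, hG⟩ := exists_isPlanarPart ε X
  have hc := hG.card_le h0 h1 hX
  -- The shift by 1 makes the potential nonnegative, as the packing estimate requires; the
  -- four-point weights total 4, hence m + 4. The constant potential 1 then compares the number of
  -- bonds outside G with the total.
  have k1 := hG.mul_card_le h0 h1 hX (U := fun r => V r + 1) (m := m + 4)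
    (fun r hr => by linarith [hV r hr]) (fun a b c d h => by linarith [hm a b c d h])
  have k2 := hG.mul_card_le h0 h1 hX (U := fun _ => 1) (m := 4)
    (fun r hr => by norm_num) (fun a b c d h => by norm_num)
  have hcard : ((bonds ε X \ G).card : ℝ) + G.card = (bonds ε X).card := by
    exact_mod_cast Finset.card_sdiff_add_card_eq_card hG.subset
  rw [Finset.sum_add_distrib, Finset.sum_const, nsmul_eq_mul, mul_one] at k1
  rw [Finset.sum_const, nsmul_eq_mul, mul_one] at k2
  nlinarith

end planar

/-! ### Hard core and the lower bound for all configurations -/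

/-- A potential of finite range with a hard core, whose four-point energy on squarish
quadrilaterals is at least `m`. -/
structure IsSquareLike (V : ℝ → ℝ) (ε m : ℝ) : Prop where
  pos : 0 < ε
  le : ε ≤ 1 / 1000
  ge : ∀ r, 0 < r → -1 ≤ V r
  far : ∀ r, Real.sqrt 2 + ε ≤ r → 0 ≤ V r
  range : ∀ r, 2 ≤ r → V r = 0
  core : ∀ r, 0 < r → r ≤ 1 - ε → 200 < V r
  outside : ∀ r, 0 < r → r ∉ Ioo (1 - ε) (Real.sqrt 2 + ε) → -(1 / 2 : ℝ) < V r
  m_ge : -4 ≤ m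
  m_le : m ≤ -(15 / 4)
  square : ∀ a b c d : Plane, IsSquarish ε a b c d → m ≤ V (dist a c) + V (dist b d) +
      1 / 2 * (V (dist a b) + V (dist b c) + V (dist c d) + V (dist d a))

theorem energy_union (V : ℝ → ℝ) {X Y : Finset Plane} [DecidableEq Plane] (h : Disjoint X Y) :
    energy V (X ∪ Y) = energy V X + energy V Y + ∑ x ∈ X, ∑ y ∈ Y, V (dist x y) := by
  have h1 : Disjoint (X ×ˢ Y) (Y ×ˢ X) := Finset.disjoint_product.2 (Or.inl h)
  have key : ∀ f : Plane × Plane → ℝ, ∑ p ∈ (X ∪ Y).offDiag, f p = ∑ p ∈ X.offDiag, f p +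
      ∑ p ∈ Y.offDiag, f p + ∑ p ∈ X ×ˢ Y, f p + ∑ p ∈ Y ×ˢ X, f p := by
    intro f
    rw [Finset.disjoint_left] at h
    rw [Finset.offDiag_union (Finset.disjoint_left.2 h), Finset.sum_union, Finset.sum_union,
      Finset.sum_union]
    all_goals
      rw [Finset.disjoint_left]
      simp only [Finset.mem_union, Finset.mem_offDiag, Finset.mem_product]
      rintro ⟨a, b⟩
      have ha := @h a
      have hb := @h b
      tauto
  unfold energy
  rw [key, Finset.sum_product, Finset.sum_product, Finset.sum_comm (s := Y) (t := X)]
  simp only [dist_comm]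
  have : ∑ x ∈ X, ∑ y ∈ Y, V (dist x y) = ∑ y ∈ X, ∑ x ∈ Y, V (dist x y) := by
    simp only [dist_comm]
  linarith

theorem energy_singleton (V : ℝ → ℝ) (x : Plane) : energy V {x} = 0 := by
  simp [energy]

theorem energy_eq_erase (V : ℝ → ℝ) [DecidableEq Plane] {X : Finset Plane} {x : Plane}
    (hx : x ∈ X) :
    energy V X = energy V (X.erase x) + ∑ y ∈ X.erase x, V (dist x y) := by
  have h : Disjoint {x} (X.erase x) := by simp
  have := energy_union V h
  rw [← Finset.insert_eq, Finset.insert_erase hx, energy_singleton, Finset.sum_singleton] at this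
  linarith

/-- Take a point x with the most points n within 1 - ε, itself included, so n ≥ 2. The range of V is
covered by 81 cells with at most n points each, so the interaction of x exceeds 200(n - 1) - 81n >
0. -/
theorem IsSquareLike.exists_removable {V : ℝ → ℝ} {ε m : ℝ} (hV : IsSquareLike V ε m)
    [DecidableEq Plane] {X : Finset Plane} (hX : ¬Separated (1 - ε) X) :
    ∃ x ∈ X, 0 < ∑ y ∈ X.erase x, V (dist x y) := by
  have h0 := hV.pos
  have h1 := hV.le
  unfold Separated at hX
  push Not at hX
  obtain ⟨a, ha, b, hb, hab, hd⟩ := hX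
  let n : Plane → ℕ := fun x => (X.filter fun y => dist x y ≤ 1 - ε).card
  obtain ⟨x, hx, hmax⟩ := X.exists_max_image n ⟨a, ha⟩
  refine ⟨x, hx, ?_⟩
  have hna : 2 ≤ n a := by
    rw [← Finset.card_pair hab]
    refine Finset.card_le_card fun z hz => ?_
    rcases Finset.mem_insert.1 hz with rfl | hz
    · exact Finset.mem_filter.2 ⟨ha, by rw [dist_self]; linarith⟩
    · obtain rfl := Finset.mem_singleton.1 hz
      exact Finset.mem_filter.2 ⟨hb, hd.le⟩
  have hnx : 2 ≤ n x := hna.trans (hmax a ha)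
  -- Cells of side 1/2 have diameter √2/2 < 1 - ε, so a cell containing y holds at most n(y) ≤ n(x)
  -- points.
  let cell : Plane → ℤ × ℤ := fun y => (⌊2 * (y 0 - x 0)⌋, ⌊2 * (y 1 - x 1)⌋)
  set B := X.filter fun y => dist x y < 2 with hB
  have himg : (B.image cell).card ≤ 81 := by
    have : B.image cell ⊆ Finset.Icc (-4) 4 ×ˢ Finset.Icc (-4) 4 := by
      rw [Finset.image_subset_iff]
      intro y hy
      have hy := (Finset.mem_filter.1 hy).2
      have hsq := dist_sq_eq x y
      have : dist x y ^ 2 < 2 ^ 2 := pow_lt_pow_left₀ hy dist_nonneg two_ne_zero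
      have b0 : |y 0 - x 0| < 2 := by
        rw [abs_lt]; constructor <;> nlinarith [sq_nonneg (x 1 - y 1)]
      have b1 : |y 1 - x 1| < 2 := by
        rw [abs_lt]; constructor <;> nlinarith [sq_nonneg (x 0 - y 0)]
      rw [abs_lt] at b0 b1
      simp only [cell, Finset.mem_product, Finset.mem_Icc, Int.le_floor]
      refine ⟨⟨?_, ?_⟩, ?_, ?_⟩
      · push_cast; linarith
      · exact Int.lt_add_one_iff.1 (Int.floor_lt.2 (by push_cast; linarith))
      · push_cast; linarith
      · exact Int.lt_add_one_iff.1 (Int.floor_lt.2 (by push_cast; linarith))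
    exact (Finset.card_le_card this).trans (by simp)
  have hfib : ∀ c ∈ B.image cell, (B.filter fun y => cell y = c).card ≤ n x := by
    intro c hc
    obtain ⟨y, hy, rfl⟩ := Finset.mem_image.1 hc
    have hyX := (Finset.mem_filter.1 hy).1
    refine (Finset.card_le_card fun z hz => ?_).trans (hmax y hyX)
    obtain ⟨hzB, hz⟩ := Finset.mem_filter.1 hz
    refine Finset.mem_filter.2 ⟨(Finset.mem_filter.1 hzB).1, ?_⟩
    obtain ⟨e0, e1⟩ := Prod.ext_iff.1 hz
    have k0 := abs_lt.1 (Int.abs_sub_lt_one_of_floor_eq_floor e0)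
    have k1 := abs_lt.1 (Int.abs_sub_lt_one_of_floor_eq_floor e1)
    have hsq := dist_sq_eq y z
    refine le_of_sq_le_sq ?_ (by linarith)
    have q0 : (y 0 - z 0) ^ 2 ≤ (1 / 2) ^ 2 := by apply sq_le_sq' <;> linarith
    have q1 : (y 1 - z 1) ^ 2 ≤ (1 / 2) ^ 2 := by apply sq_le_sq' <;> linarith
    nlinarith
  have hBcard : B.card ≤ n x * 81 :=
    (Finset.card_le_mul_card_image B _ hfib).trans (Nat.mul_le_mul_left _ himg)
  have hpt : ∀ y ∈ X.erase x, (if dist x y ≤ 1 - ε then (200 : ℝ) else 0) -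
      (if dist x y < 2 then 1 else 0) ≤ V (dist x y) := by
    intro y hy
    have hpos := dist_pos.2 (Finset.ne_of_mem_erase hy).symm
    split_ifs with h2 h3 h3
    · linarith [hV.core _ hpos h2]
    · linarith
    · linarith [hV.ge _ hpos]
    · rw [hV.range _ (not_lt.1 h3)]; norm_num
  have hsum := Finset.sum_le_sum hpt
  rw [Finset.sum_sub_distrib, ← Finset.sum_filter, ← Finset.sum_filter, Finset.sum_const,
    Finset.sum_const, nsmul_eq_mul, nsmul_eq_mul, Finset.filter_erase, Finset.card_erase_of_mem
    (Finset.mem_filter.2 ⟨hx, by rw [dist_self]; linarith⟩)] at hsum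
  have hc2 : (((X.erase x).filter fun y => dist x y < 2).card : ℝ) ≤ n x * 81 := by
    refine le_trans ?_ (Nat.cast_le.2 hBcard |>.trans (by push_cast; rfl))
    exact_mod_cast Finset.card_le_card (Finset.filter_subset_filter _ (Finset.erase_subset _ _))
  have hc1 : (((X.filter fun y => dist x y ≤ 1 - ε).card - 1 : ℕ) : ℝ) = n x - 1 := by
    rw [Nat.cast_sub (by change 1 ≤ n x; omega)]; simp [n]
  rw [hc1] at hsum
  have : (2 : ℝ) ≤ n x := by exact_mod_cast hnx
  linarith

/-- Induction on N: a removable point has positive interaction and m < 0, so the bound passes from N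
to N + 1; separated configurations need no induction. -/
theorem IsSquareLike.le_energy {V : ℝ → ℝ} {ε m : ℝ} (hV : IsSquareLike V ε m) :
    ∀ (N : ℕ) (X : Finset Plane), X.card = N → N * m ≤ energy V X := by
  classical
  have hm := hV.m_le
  intro N
  induction N with
  | zero =>
    intro X hX
    rw [Finset.card_eq_zero] at hX
    simp [hX, energy]
  | succ N ih =>
    intro X hX
    by_cases hsep : Separated (1 - ε) X
    · have h := sum_bonds_ge hV.pos hV.le hsep hV.ge hV.m_ge (by linarith) hV.square
      have h2 : ∑ e ∈ bonds ε X, V (dist e.1 e.2) ≤ ∑ e ∈ X.offDiag, V (dist e.1 e.2) := by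
        refine Finset.sum_le_sum_of_subset_of_nonneg (Finset.filter_subset _ _) fun e he hne => ?_
        refine hV.far _ (not_lt.1 fun h => hne ?_)
        exact Finset.mem_filter.2 ⟨he, h⟩
      rw [hX] at h
      unfold energy
      linarith
    · obtain ⟨x, hx, hpos⟩ := hV.exists_removable hsep
      rw [energy_eq_erase V hx]
      have := ih (X.erase x) (by rw [Finset.card_erase_of_mem hx, hX]; rfl)
      push_cast
      linarith

/-! ### Four-point energies and the reduction of the hypotheses -/

theorem fourPointEnergy_eq (V : ℝ → ℝ) (x : Fin 4 → Plane) :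
    fourPointEnergy V x = V (dist (x 0) (x 2)) + V (dist (x 1) (x 3)) +
      1 / 2 * (V (dist (x 0) (x 1)) + V (dist (x 1) (x 2)) + V (dist (x 2) (x 3)) +
        V (dist (x 3) (x 0))) := by
  have h : fourPointEnergy V x = 1 / 2 * ((V (dist (x 0) (x 1)) + V (dist (x 1) (x 2)) +
      V (dist (x 2) (x 3)) + V (dist (x 3) (x 0))) + (V (dist (x 0) (x 2)) +
      V (dist (x 1) (x 3)) + V (dist (x 2) (x 0)) + V (dist (x 3) (x 1)))) := by
    rw [fourPointEnergy, Fin.sum_univ_four, Fin.sum_univ_four]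
    rfl
  rw [h, dist_comm (x 2) (x 0), dist_comm (x 3) (x 1)]
  ring

theorem dist_unitSquare : dist (unitSquare 0) (unitSquare 2) = Real.sqrt 2 ∧
    dist (unitSquare 1) (unitSquare 3) = Real.sqrt 2 ∧ dist (unitSquare 0) (unitSquare 1) = 1 ∧
    dist (unitSquare 1) (unitSquare 2) = 1 ∧ dist (unitSquare 2) (unitSquare 3) = 1 ∧
    dist (unitSquare 3) (unitSquare 0) = 1 := by
  refine ⟨?_, ?_, ?_, ?_, ?_, ?_⟩ <;> rw [EuclideanSpace.dist_eq, Fin.sum_univ_two] <;>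
    simp [unitSquare, Real.dist_eq] <;> norm_num

theorem fourPointEnergy_unitSquare (V : ℝ → ℝ) :
    fourPointEnergy V unitSquare = 2 * V 1 + 2 * V (Real.sqrt 2) := by
  obtain ⟨h1, h2, h3, h4, h5, h6⟩ := dist_unitSquare
  rw [fourPointEnergy_eq, h1, h2, h3, h4, h5, h6]
  ring

theorem isQuadrilateral_unitSquare : IsQuadrilateral unitSquare := by
  obtain ⟨h1, h2, h3, h4, h5, h6⟩ := dist_unitSquare
  have s : (0 : ℝ) < Real.sqrt 2 := by positivity
  have n02 : unitSquare 0 ≠ unitSquare 2 := dist_pos.1 (by linarith)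
  have n13 : unitSquare 1 ≠ unitSquare 3 := dist_pos.1 (by linarith)
  have n01 : unitSquare 0 ≠ unitSquare 1 := dist_pos.1 (by linarith)
  have n12 : unitSquare 1 ≠ unitSquare 2 := dist_pos.1 (by linarith)
  have n23 : unitSquare 2 ≠ unitSquare 3 := dist_pos.1 (by linarith)
  have n30 : unitSquare 3 ≠ unitSquare 0 := dist_pos.1 (by linarith)
  refine ⟨fun i j h => ?_, fun _ => ⟨0, ?_, ?_⟩⟩
  · fin_cases i <;> fin_cases j <;> first | rfl | (exfalso; simp only [] at h; tauto)
  · refine ⟨1 / 2, 1 / 2, by norm_num, by norm_num, by norm_num, ?_⟩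
    ext i; fin_cases i <;> simp [unitSquare] <;> norm_num
  · refine ⟨1 / 2, 1 / 2, by norm_num, by norm_num, by norm_num, ?_⟩
    ext i; fin_cases i <;> simp [unitSquare] <;> norm_num

/-- An energy below m ≤ -15/4 exceeds the absolute bound -4 by less than 1/4, so with weights at
least 1/2 all six values of V are below -1/2. All distances are then bond lengths: in convex
position the points form a near-square, and otherwise one point is too close to another. -/
theorem IsSquareLike.le_fourPointEnergy {V : ℝ → ℝ} {ε m : ℝ} (hV : IsSquareLike V ε m)
    {x : Fin 4 → Plane} (hx : IsQuadrilateral x) : m ≤ fourPointEnergy V x := by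
  classical
  by_contra hlt
  have h0 := hV.pos
  have h1 := hV.le
  have hm := hV.m_le
  have key : fourPointEnergy V x < -(15 / 4) := by linarith [not_le.1 hlt]
  rw [fourPointEnergy_eq] at key hlt
  have pos : ∀ i j, i ≠ j → 0 < dist (x i) (x j) := fun i j h => dist_pos.2 (hx.1.ne h)
  have g02 := hV.ge _ (pos 0 2 (by decide))
  have g13 := hV.ge _ (pos 1 3 (by decide))
  have g01 := hV.ge _ (pos 0 1 (by decide))
  have g12 := hV.ge _ (pos 1 2 (by decide))
  have g23 := hV.ge _ (pos 2 3 (by decide))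
  have g30 := hV.ge _ (pos 3 0 (by decide))
  have mem : ∀ i j, i ≠ j → V (dist (x i) (x j)) ≤ -(1 / 2) →
      dist (x i) (x j) ∈ Ioo (1 - ε) (Real.sqrt 2 + ε) := by
    intro i j hij h
    by_contra hn
    linarith [hV.outside _ (pos i j hij) hn]
  have m02 := mem 0 2 (by decide) (by linarith)
  have m13 := mem 1 3 (by decide) (by linarith)
  have m01 := mem 0 1 (by decide) (by linarith)
  have m12 := mem 1 2 (by decide) (by linarith)
  have m23 := mem 2 3 (by decide) (by linarith)
  have m30 := mem 3 0 (by decide) (by linarith)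
  by_cases hc : ConvexIndependent ℝ x
  · rcases isSquarish_of_crossing h0 h1 (hx.2 hc) (by rw [dist_comm]; exact m01.1.le) m12.1.le
      m30.1.le (by rw [dist_comm]; exact m23.1.le) m02.2.le m13.2.le with h | h
    · exact hlt (hV.square _ _ _ _ h)
    · have := hV.square _ _ _ _ h
      rw [dist_comm (x 3) (x 1), dist_comm (x 0) (x 3), dist_comm (x 3) (x 2),
        dist_comm (x 2) (x 1), dist_comm (x 1) (x 0)] at this
      linarith
  · have mall : ∀ i j, i ≠ j → dist (x i) (x j) ∈ Ioo (1 - ε) (Real.sqrt 2 + ε) := by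
      intro i j hij
      fin_cases i <;> fin_cases j <;> first | exact absurd rfl hij | assumption |
        (rw [dist_comm]; assumption)
    rw [convexIndependent_iff_notMem_convexHull_sdiff] at hc
    push Not at hc
    obtain ⟨i, s, hs⟩ := hc
    have hs' : x i ∈ convexHull ℝ (((Finset.univ.erase i).image x : Finset Plane) : Set Plane) := by
      refine convexHull_mono ?_ hs
      rintro _ ⟨j, ⟨-, hj⟩, rfl⟩
      simpa using ⟨j, hj, rfl⟩
    rw [Finset.mem_convexHull'] at hs'
    obtain ⟨w, hw0, hw1, hw⟩ := hs'
    have B := fun r => @bond_sq_mem ε r h0 h1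
    refine sum_smul_ne_of_far (t := (Finset.univ.erase i).image x)
      (Finset.card_image_le.trans (by simp)) hw0 hw1 (x := id) (p := x i) ?_ ?_ hw
    · intro y hy
      obtain ⟨j, hj, rfl⟩ := Finset.mem_image.1 hy
      have := mall i j (Finset.ne_of_mem_erase hj).symm
      have := (B _ this.1.le this.2.le).1
      simp only [id]; linarith
    · intro y hy z hz
      obtain ⟨j, hj, rfl⟩ := Finset.mem_image.1 hy
      obtain ⟨k, hk, rfl⟩ := Finset.mem_image.1 hz
      rcases eq_or_ne j k with rfl | hjk
      · simp; norm_num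
      · have := mall j k hjk
        have := (B _ this.1.le this.2.le).2
        simp only [id]; linarith

/-- The finite range conditions give a hard core potential that is nonnegative slightly beyond the
diagonal of the unit square. -/
theorem FiniteRangeConditions.isSquareLike {V : ℝ → ℝ} {α' α α'' : ℝ}
    (hV : FiniteRangeConditions V α' α α'' 200) (h0 : 0 < α') (h1 : α' < α)
    (h2 : α < α'' / 1000) (h3 : α'' < (2 - Real.sqrt 2) / 4)
    (hmin : SquareIsOnlyMinimizer V α'') :
    IsSquareLike V (3 * α) (fourPointEnergy V unitSquare) := by
  obtain ⟨q1, q2⟩ := sqrt_two_mem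
  have hge : ∀ r, 0 < r → -1 ≤ V r := fun r hr => hV.min_eq.2 ⟨r, hr, rfl⟩
  obtain ⟨w, hw, hwell⟩ := hV.well
  have hw1 : V 1 ≤ w := hwell 1 (Or.inl ⟨by linarith, by linarith⟩)
  have hw2 : V (Real.sqrt 2) ≤ w := hwell _ (Or.inr ⟨by linarith, by linarith⟩)
  refine ⟨by linarith, by linarith, hge, ?_, fun r hr => hV.range r (by linarith),
    fun r hr hr' => hV.repulsion r hr (by linarith), ?_, ?_, ?_, ?_⟩
  · intro r hr
    rcases le_or_gt (Real.sqrt 2 + α'') r with h | h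
    · exact (hV.range r h).ge
    · have hd : 0 < r - Real.sqrt 2 := by linarith
      -- The reason for ε = 3α: the weight of √2 is at least 2/3, and (2/3)(15/16) = 5/8 > 1/2. A
      -- negative V(r) would therefore contradict V(√2 + α) > -1/2.
      have hl : α / (r - Real.sqrt 2) ≤ 1 / 3 := by
        rw [div_le_div_iff₀ hd (by norm_num)]; linarith
      have hl0 : 0 < α / (r - Real.sqrt 2) := div_pos (by linarith) hd
      have hcv := hV.convex_diag.2
        (show Real.sqrt 2 ∈ diagRange α'' from ⟨by linarith, by linarith⟩)
        (show r ∈ diagRange α'' from ⟨by linarith, by linarith⟩)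
        (show 0 ≤ 1 - α / (r - Real.sqrt 2) by linarith) hl0.le (by ring)
      have e : (1 - α / (r - Real.sqrt 2)) • Real.sqrt 2 + (α / (r - Real.sqrt 2)) • r =
          Real.sqrt 2 + α := by
        simp only [smul_eq_mul]; field_simp; ring
      rw [e, smul_eq_mul, smul_eq_mul] at hcv
      have ho := hV.outside (Real.sqrt 2 + α) (by linarith) (fun h => lt_irrefl _ h.2)
      set l := α / (r - Real.sqrt 2)
      by_contra hneg
      have : l * V r < 0 := mul_neg_of_pos_of_neg hl0 (not_le.1 hneg)
      nlinarith
  · intro r hr hn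
    exact hV.outside r hr fun h => hn ⟨by linarith [h.1], by linarith [h.2]⟩
  · rw [fourPointEnergy_unitSquare]
    linarith [hge 1 (by norm_num), hge (Real.sqrt 2) (by linarith)]
  · rw [fourPointEnergy_unitSquare]; linarith
  · intro a b c d h
    have hmem : ![a, b, c, d] ∈ nearSquares α'' := by
      -- The near-square tolerance is 16ε = 48α, below α''.
      have S : sideRange (16 * (3 * α)) ⊆ sideRange α'' :=
        Ioo_subset_Ioo (by linarith) (by linarith)
      have D : diagRange (16 * (3 * α)) ⊆ diagRange α'' :=
        Ioo_subset_Ioo (by linarith) (by linarith)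
      refine ⟨fun i => ?_, D h.ac, D h.bd⟩
      fin_cases i
      exacts [S h.ab, S h.bc, S h.cd, S h.da]
    have := hmin.1 _ hmem
    rwa [fourPointEnergy_eq V ![a, b, c, d]] at this

/-! ### Energy per point of square lattices -/

theorem mem_latticeBall {t : ℝ} (ht : 0 < t) {R : ℝ} {x : Plane} :
    x ∈ latticeBall ht R ↔ x ∈ squareLattice t ∧ ‖x‖ < R := by
  simp [latticeBall]

theorem add_mem_squareLattice {t : ℝ} {x y : Plane} (hx : x ∈ squareLattice t)
    (hy : y ∈ squareLattice t) : x + y ∈ squareLattice t := by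
  obtain ⟨a, b, rfl⟩ := hx
  obtain ⟨c, d, rfl⟩ := hy
  exact ⟨a + c, b + d, by apply plane_ext <;> simp <;> ring⟩

theorem neg_mem_squareLattice {t : ℝ} {x : Plane} (hx : x ∈ squareLattice t) :
    -x ∈ squareLattice t := by
  obtain ⟨a, b, rfl⟩ := hx
  exact ⟨-a, -b, by apply plane_ext <;> simp⟩

/-- The energy of a subset of a lattice in terms of the numbers of pairs with given difference. -/
theorem energy_eq_sum_card {V : ℝ → ℝ} (hV : ∀ r, 2 ≤ r → V r = 0) [DecidableEq Plane] {t : ℝ}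
    {X F : Finset Plane} (hX : ∀ x ∈ X, x ∈ squareLattice t) (hF0 : ∀ v ∈ F, v ≠ 0)
    (hF : ∀ v ∈ squareLattice t, v ≠ 0 → ‖v‖ < 2 → v ∈ F) :
    energy V X = 1 / 2 * ∑ v ∈ F, V ‖v‖ * ((X.filter fun x => x + v ∈ X).card : ℝ) := by
  unfold energy
  congr 1
  have h1 : ∑ p ∈ X.offDiag, V (dist p.1 p.2) =
      ∑ p ∈ X.offDiag.filter (fun p => p.2 - p.1 ∈ F), V (dist p.1 p.2) := by
    symm
    refine Finset.sum_subset (Finset.filter_subset _ _) fun p hp hn => ?_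
    rw [Finset.mem_offDiag] at hp
    refine hV _ (not_lt.1 fun h => hn (Finset.mem_filter.2 ⟨Finset.mem_offDiag.2 hp, ?_⟩))
    refine hF _ ?_ (sub_ne_zero.2 hp.2.2.symm) (by rwa [← dist_eq_norm, dist_comm])
    rw [sub_eq_add_neg]
    exact add_mem_squareLattice (hX _ hp.2.1) (neg_mem_squareLattice (hX _ hp.1))
  rw [h1, ← Finset.sum_fiberwise_of_maps_to (g := fun p => p.2 - p.1) (t := F)
    (s := X.offDiag.filter fun p => p.2 - p.1 ∈ F) (fun p hp => (Finset.mem_filter.1 hp).2)]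
  refine Finset.sum_congr rfl fun v hv => ?_
  rw [mul_comm, ← nsmul_eq_mul, ← Finset.sum_const]
  refine Finset.sum_nbij' (fun p => p.1) (fun x => (x, x + v)) ?_ ?_ ?_ ?_ ?_
  · rintro ⟨x, y⟩ h
    simp only [Finset.mem_filter, Finset.mem_offDiag] at h
    simp only [Finset.mem_filter, ← h.2]
    exact ⟨h.1.1.1, by simpa using h.1.1.2.1⟩
  · intro x h
    rw [Finset.mem_filter] at h
    simp only [Finset.mem_filter, Finset.mem_offDiag]
    simpa [h.1, h.2, hv] using hF0 v hv
  · rintro ⟨x, y⟩ h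
    simp only [Finset.mem_filter, Finset.mem_offDiag] at h
    simp [← h.2]
  · intro x h; rfl
  · rintro ⟨x, y⟩ h
    simp only [Finset.mem_filter, Finset.mem_offDiag] at h
    simp only [← h.2, dist_comm x y, dist_eq_norm]

-- Lattice points in a growing disc are asymptotically proportional to its area. Positivity of the
-- limit is all that is needed, since only ratios of counts enter later.
open scoped Pointwise in
theorem tendsto_card_latticeBall {t : ℝ} (ht : 0 < t) :
    ∃ c : ℝ, 0 < c ∧
      Tendsto (fun R : ℝ => ((latticeBall ht R).card : ℝ) / R ^ 2) atTop (𝓝 c) := by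
  let s : Set (Fin 2 → ℝ) := {f | ‖(WithLp.toLp 2 f : Plane)‖ < 1}
  have hcont : Continuous fun f : Fin 2 → ℝ => (WithLp.toLp 2 f : Plane) :=
    PiLp.continuous_toLp 2 _
  have hopen : IsOpen s := isOpen_lt hcont.norm continuous_const
  have hconv : Convex ℝ s := by
    intro f hf g hg a b ha hb hab
    have := convex_ball (0 : Plane) 1 (mem_ball_zero_iff.2 hf) (mem_ball_zero_iff.2 hg) ha hb hab
    exact mem_ball_zero_iff.1 this
  have hbdd : Bornology.IsBounded s := by
    refine (Metric.isBounded_closedBall (x := (0 : Fin 2 → ℝ)) (r := 1)).subset fun f hf => ?_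
    rw [mem_closedBall_zero_iff, pi_norm_le_iff_of_nonneg zero_le_one]
    exact fun i => (PiLp.norm_apply_le (WithLp.toLp 2 f : Plane) i).trans (le_of_lt hf)
  have hmono : ∀ ⦃x y : ℝ⦄, 0 < x → x ≤ y → x • s ⊆ y • s := by
    intro x y hx hxy
    rintro _ ⟨f, hf, rfl⟩
    have hy := hx.trans_le hxy
    refine ⟨(x / y) • f, ?_, ?_⟩
    · have : ‖(WithLp.toLp 2 f : Plane)‖ < 1 := hf
      change ‖(WithLp.toLp 2 ((x / y) • f) : Plane)‖ < 1
      rw [WithLp.toLp_smul, norm_smul, Real.norm_of_nonneg (by positivity)]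
      have : x / y ≤ 1 := (div_le_one hy).2 hxy
      have : 0 < x / y := by positivity
      nlinarith [norm_nonneg (WithLp.toLp 2 f : Plane)]
    · simp only [smul_smul]; congr 1; field_simp
  have hpos : 0 < (MeasureTheory.volume.real s) :=
    ENNReal.toReal_pos (hopen.measure_pos _ ⟨0, by simp [s]⟩).ne' hbdd.measure_lt_top.ne
  have key := tendsto_card_div_pow_atTop_volume' s hbdd hopen.measurableSet
    (hconv.addHaar_frontier MeasureTheory.volume) hmono
  have hdiv : Tendsto (fun R : ℝ => R / t) atTop atTop := tendsto_id.atTop_div_const ht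
  have key2 := (key.comp hdiv).mul_const (1 / t ^ 2)
  refine ⟨_, mul_pos hpos (show 0 < 1 / t ^ 2 by positivity), key2.congr' ?_⟩
  filter_upwards [eventually_gt_atTop 0] with R hR
  have hset : s ∩ ((R / t)⁻¹ • (Submodule.span ℤ (Set.range (Pi.basisFun ℝ (Fin 2))) :
      Set (Fin 2 → ℝ))) =
      (fun v : Plane => R⁻¹ • (WithLp.ofLp v)) '' (latticeBall ht R : Set Plane) := by
    have hRt : R / t ≠ 0 := by positivity
    ext f
    simp only [mem_inter_iff, mem_image, mem_latticeBall, Set.mem_smul_set,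
      SetLike.mem_coe, Module.Basis.mem_span_iff_repr_mem, Pi.basisFun_repr, Fin.forall_fin_two]
    constructor
    · rintro ⟨hf, g, ⟨⟨a, ha⟩, b, hb⟩, rfl⟩
      simp only [algebraMap_int_eq, eq_intCast] at ha hb
      refine ⟨R • WithLp.toLp 2 ((R / t)⁻¹ • g), ⟨⟨a, b, ?_⟩, ?_⟩, ?_⟩
      · apply plane_ext
        · simp [ha]; field_simp
        · simp [hb]; field_simp
      · rw [norm_smul, Real.norm_of_nonneg hR.le]
        have : ‖(WithLp.toLp 2 ((R / t)⁻¹ • g) : Plane)‖ < 1 := hf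
        nlinarith
      · simp [smul_smul, hR.ne']
    · rintro ⟨v, ⟨⟨a, b, hv⟩, hv2⟩, rfl⟩
      refine ⟨?_, ![a, b], ⟨⟨a, by simp⟩, b, by simp⟩, ?_⟩
      · change ‖(WithLp.toLp 2 (R⁻¹ • WithLp.ofLp v) : Plane)‖ < 1
        rw [WithLp.toLp_smul, norm_smul, Real.norm_of_nonneg (by positivity), WithLp.toLp_ofLp,
          inv_mul_lt_iff₀ hR, mul_one]
        exact hv2
      · rw [hv]
        ext i; fin_cases i <;> simp <;> field_simp
  have hcard : Nat.card ↑(s ∩ ((R / t)⁻¹ • (Submodule.span ℤ (Set.range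
      (Pi.basisFun ℝ (Fin 2))) : Set (Fin 2 → ℝ)))) = (latticeBall ht R).card := by
    rw [hset, Nat.card_image_of_injective, Nat.card_coe_set_eq, Set.ncard_coe_finset]
    intro v w h
    have h2 : WithLp.ofLp v = WithLp.ofLp w := smul_right_injective _ (inv_ne_zero hR.ne') h
    exact WithLp.ofLp_injective 2 h2
  simp only [Function.comp_apply]
  rw [hcard, Fintype.card_fin]
  field_simp

theorem tendsto_card_latticeBall_sub {t : ℝ} (ht : 0 < t) (c : ℝ) :
    Tendsto (fun R : ℝ => ((latticeBall ht (R - c)).card : ℝ) / (latticeBall ht R).card) atTop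
      (𝓝 1) := by
  obtain ⟨l, hl, h⟩ := tendsto_card_latticeBall ht
  have hsub : Tendsto (fun R : ℝ => R - c) atTop atTop := tendsto_atTop_add_const_right _ _ tendsto_id
  have h1 := h.comp hsub
  have h2 : Tendsto (fun R : ℝ => (R - c) / R) atTop (𝓝 1) := by
    have : Tendsto (fun R : ℝ => 1 - c / R) atTop (𝓝 (1 - 0)) :=
      tendsto_const_nhds.sub (tendsto_const_nhds.div_atTop tendsto_id)
    rw [sub_zero] at this
    refine this.congr' ?_
    filter_upwards [eventually_gt_atTop 0] with R hR
    field_simp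
  have h3 := (h1.mul (h2.pow 2)).div h hl.ne'
  rw [one_pow, mul_one, div_self hl.ne'] at h3
  refine h3.congr' ?_
  filter_upwards [eventually_gt_atTop 0, eventually_gt_atTop c] with R hR hRc
  have : R - c ≠ 0 := by linarith
  simp only [Function.comp_apply, Pi.div_apply]
  field_simp

/-- The energy per point of a square lattice. -/
theorem isLatticeEnergy_sum {V : ℝ → ℝ} (hV : ∀ r, 2 ≤ r → V r = 0) {t : ℝ} (ht : 0 < t)
    {F : Finset Plane} (hF0 : ∀ v ∈ F, v ≠ 0) (hF1 : ∀ v ∈ F, v ∈ squareLattice t)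
    (hF : ∀ v ∈ squareLattice t, v ≠ 0 → ‖v‖ < 2 → v ∈ F) :
    IsLatticeEnergy V ht (1 / 2 * ∑ v ∈ F, V ‖v‖) := by
  classical
  unfold IsLatticeEnergy
  -- Translation by v keeps the ball of radius R - |v| inside the ball of radius R, so almost every
  -- point has its v-neighbour.
  have hcount : ∀ v ∈ F, Tendsto (fun R : ℝ => (((latticeBall ht R).filter
      fun x => x + v ∈ latticeBall ht R).card : ℝ) / (latticeBall ht R).card) atTop (𝓝 1) := by
    intro v hv
    refine tendsto_of_tendsto_of_tendsto_of_le_of_le (tendsto_card_latticeBall_sub ht ‖v‖)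
      tendsto_const_nhds (fun R => ?_) (fun R => ?_)
    · refine div_le_div_of_nonneg_right (Nat.cast_le.2 (Finset.card_le_card fun x hx => ?_))
        (Nat.cast_nonneg _)
      rw [mem_latticeBall] at hx
      rw [Finset.mem_filter, mem_latticeBall, mem_latticeBall]
      exact ⟨⟨hx.1, by linarith [norm_nonneg v]⟩, add_mem_squareLattice hx.1 (hF1 v hv),
        (norm_add_le _ _).trans_lt (by linarith)⟩
    · exact div_le_one_of_le₀ (Nat.cast_le.2 (Finset.card_filter_le _ _)) (Nat.cast_nonneg _)
  have := (tendsto_finsetSum F fun v hv => (hcount v hv).const_mul (V ‖v‖)).const_mul (1 / 2)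
  simp only [mul_one] at this
  refine this.congr fun R => ?_
  rw [energy_eq_sum_card hV (fun x hx => ((mem_latticeBall ht).1 hx).1) hF0 hF, mul_div_assoc,
    Finset.sum_div]
  simp only [mul_div_assoc]

theorem exists_isLatticeEnergy {V : ℝ → ℝ} (hV : ∀ r, 2 ≤ r → V r = 0) {t : ℝ} (ht : 0 < t) :
    ∃ l, IsLatticeEnergy V ht l := by
  classical
  refine ⟨_, isLatticeEnergy_sum hV ht (F := (latticeBall ht 2).erase 0) (fun v hv => ?_)
    (fun v hv => ?_) (fun v hv h0 h2 => ?_)⟩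
  · exact Finset.ne_of_mem_erase hv
  · exact ((mem_latticeBall ht).1 (Finset.mem_of_mem_erase hv)).1
  · exact Finset.mem_erase.2 ⟨h0, (mem_latticeBall ht).2 ⟨hv, h2⟩⟩

/-! ### Distant unions, grids and the upper bound -/

theorem energy_image_add (V : ℝ → ℝ) [DecidableEq Plane] (X : Finset Plane) (v : Plane) :
    energy V (X.image fun x => x + v) = energy V X := by
  unfold energy
  congr 1
  refine Finset.sum_nbij' (fun p => (p.1 - v, p.2 - v)) (fun p => (p.1 + v, p.2 + v)) ?_ ?_ ?_ ?_ ?_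
  · rintro ⟨x, y⟩ h
    simp only [Finset.mem_offDiag, Finset.mem_image] at h
    obtain ⟨⟨x, hx, rfl⟩, ⟨y, hy, rfl⟩, hne⟩ := h
    simpa [hx, hy] using hne
  · rintro ⟨x, y⟩ h
    rw [Finset.mem_offDiag] at h
    simpa [Finset.mem_offDiag] using h
  · rintro ⟨x, y⟩ h; simp
  · rintro ⟨x, y⟩ h; simp
  · rintro ⟨x, y⟩ h; simp

/-- Two configurations can be placed so far apart that they do not interact. -/
theorem exists_energy_add {V : ℝ → ℝ} (hV : ∀ r, 2 ≤ r → V r = 0) (X Y : Finset Plane) :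
    ∃ Z : Finset Plane, Z.card = X.card + Y.card ∧ energy V Z = energy V X + energy V Y := by
  classical
  set c : ℝ := 2 + ∑ x ∈ X, ‖x‖ + ∑ y ∈ Y, ‖y‖ with hc
  have hc0 : 0 ≤ c := by positivity
  let v : Plane := !₂[c, 0]
  have hv : c ≤ ‖v‖ := by
    have := PiLp.norm_apply_le v 0
    rwa [show v 0 = c from rfl, Real.norm_of_nonneg hc0] at this
  have hfar : ∀ x ∈ X, ∀ y ∈ Y.image (fun y => y + v), 2 ≤ dist x y := by
    intro x hx y' hy'
    obtain ⟨y, hy, rfl⟩ := Finset.mem_image.1 hy'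
    have h1 : ‖x‖ ≤ ∑ x ∈ X, ‖x‖ :=
      Finset.single_le_sum (f := fun x : Plane => ‖x‖) (fun _ _ => norm_nonneg _) hx
    have h2 : ‖y‖ ≤ ∑ y ∈ Y, ‖y‖ :=
      Finset.single_le_sum (f := fun x : Plane => ‖x‖) (fun _ _ => norm_nonneg _) hy
    have h3 : ‖v‖ ≤ dist x (y + v) + ‖x‖ + ‖y‖ := by
      have e : v = (y + v - x) + (x - y) := by abel
      calc ‖v‖ = ‖(y + v - x) + (x - y)‖ := by rw [← e]
        _ ≤ ‖y + v - x‖ + ‖x - y‖ := norm_add_le _ _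
        _ ≤ ‖y + v - x‖ + (‖x‖ + ‖y‖) := by gcongr; exact norm_sub_le _ _
        _ = _ := by rw [dist_comm, dist_eq_norm]; ring
    linarith
  have hdis : Disjoint X (Y.image fun y => y + v) := by
    rw [Finset.disjoint_left]
    intro x hx hy
    have := hfar x hx x hy
    rw [dist_self] at this
    linarith
  refine ⟨X ∪ Y.image fun y => y + v, ?_, ?_⟩
  · rw [Finset.card_union_of_disjoint hdis, Finset.card_image_of_injective _ (add_left_injective v)]
  · rw [energy_union V hdis, energy_image_add, Finset.sum_eq_zero, add_zero]
    exact fun x hx => Finset.sum_eq_zero fun y hy => hV _ (hfar x hx y hy)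

theorem exists_energy_eq_of_card_add {V : ℝ → ℝ} (hV : ∀ r, 2 ≤ r → V r = 0) (X : Finset Plane)
    (n : ℕ) : ∃ Z : Finset Plane, Z.card = X.card + n ∧ energy V Z = energy V X := by
  induction n with
  | zero => exact ⟨X, rfl, rfl⟩
  | succ n ih =>
    obtain ⟨Z, h1, h2⟩ := ih
    obtain ⟨W, h3, h4⟩ := exists_energy_add hV Z {0}
    exact ⟨W, by rw [h3, h1, Finset.card_singleton, add_assoc],
      by rw [h4, energy_singleton, h2, add_zero]⟩

/-- The points of the unit square lattice. -/
noncomputable def latticePoint (p : ℤ × ℤ) : Plane := !₂[(p.1 : ℝ), (p.2 : ℝ)]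

theorem latticePoint_injective : Function.Injective latticePoint := by
  intro p q h
  have h0 : latticePoint p 0 = latticePoint q 0 := by rw [h]
  have h1 : latticePoint p 1 = latticePoint q 1 := by rw [h]
  simp only [latticePoint] at h0 h1
  exact Prod.ext (by simpa using h0) (by simpa using h1)

theorem latticePoint_mem (p : ℤ × ℤ) : latticePoint p ∈ squareLattice 1 :=
  ⟨p.1, p.2, by simp [latticePoint]⟩

theorem norm_latticePoint (p : ℤ × ℤ) :
    ‖latticePoint p‖ = Real.sqrt ((p.1 : ℝ) ^ 2 + (p.2 : ℝ) ^ 2) := by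
  simp [latticePoint, EuclideanSpace.norm_eq, Fin.sum_univ_two]

theorem latticePoint_add (p q : ℤ × ℤ) :
    latticePoint (p + q) = latticePoint p + latticePoint q := by
  apply plane_ext <;> simp [latticePoint]

/-- The coordinates of the eight neighbours of the origin. -/
def neighbourIndices : Finset (ℤ × ℤ) :=
  {(1, 0), (-1, 0), (0, 1), (0, -1), (1, 1), (1, -1), (-1, 1), (-1, -1)}

theorem mem_neighbourIndices (p : ℤ × ℤ) :
    p ∈ neighbourIndices ↔ p ≠ 0 ∧ |p.1| ≤ 1 ∧ |p.2| ≤ 1 := by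
  obtain ⟨a, b⟩ := p
  simp only [neighbourIndices, Finset.mem_insert, Finset.mem_singleton, Prod.mk.injEq, ne_eq,
    Prod.mk_eq_zero, abs_le]
  omega

open Classical in
/-- The eight neighbours of the origin. -/
noncomputable def neighbours : Finset Plane := neighbourIndices.image latticePoint

theorem neighbours_ne_zero : ∀ v ∈ neighbours, v ≠ 0 := by
  intro v hv
  obtain ⟨p, hp, rfl⟩ := Finset.mem_image.1 hv
  have h0 : latticePoint 0 = 0 := by apply plane_ext <;> simp [latticePoint]
  rw [← h0]
  exact latticePoint_injective.ne ((mem_neighbourIndices p).1 hp).1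

theorem neighbours_mem : ∀ v ∈ neighbours, v ∈ squareLattice 1 := by
  intro v hv
  obtain ⟨p, hp, rfl⟩ := Finset.mem_image.1 hv
  exact latticePoint_mem p

theorem mem_neighbours : ∀ v ∈ squareLattice 1, v ≠ 0 → ‖v‖ < 2 → v ∈ neighbours := by
  rintro v ⟨a, b, rfl⟩ hv h2
  have e : (!₂[1 * (a : ℝ), 1 * (b : ℝ)] : Plane) = latticePoint (a, b) := by
    simp [latticePoint]
  rw [e] at hv h2 ⊢
  rw [norm_latticePoint, Real.sqrt_lt' (by norm_num)] at h2
  simp only at h2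
  refine Finset.mem_image_of_mem _ ((mem_neighbourIndices _).2 ⟨?_, ?_, ?_⟩)
  · rintro h
    refine hv ?_
    rw [h]
    apply plane_ext <;> simp [latticePoint]
  · have : a ^ 2 + b ^ 2 < 2 ^ 2 := by exact_mod_cast h2
    simp only [abs_le]; constructor <;> nlinarith [sq_nonneg b]
  · have : a ^ 2 + b ^ 2 < 2 ^ 2 := by exact_mod_cast h2
    simp only [abs_le]; constructor <;> nlinarith [sq_nonneg a]

theorem sum_neighbours (f : ℝ → ℝ) :
    ∑ v ∈ neighbours, f ‖v‖ = 4 * f 1 + 4 * f (Real.sqrt 2) := by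
  rw [neighbours, Finset.sum_image latticePoint_injective.injOn]
  simp only [norm_latticePoint, neighbourIndices]
  repeat rw [Finset.sum_insert (by decide)]
  rw [Finset.sum_singleton]
  norm_num
  ring

open Classical in
/-- The `k × k` grid. -/
noncomputable def grid (k : ℕ) : Finset Plane :=
  (Finset.Ico (0 : ℤ) k ×ˢ Finset.Ico (0 : ℤ) k).image latticePoint

theorem card_grid (k : ℕ) : (grid k).card = k ^ 2 := by
  rw [grid, Finset.card_image_of_injective _ latticePoint_injective, Finset.card_product]
  simp [sq]

open Classical in
theorem card_grid_inter_ge (k : ℕ) {v : Plane} (hv : v ∈ neighbours) :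
    (k - 1) ^ 2 ≤ ((grid k).filter fun x => x + v ∈ grid k).card := by
  obtain ⟨⟨a, b⟩, hp, rfl⟩ := Finset.mem_image.1 hv
  obtain ⟨-, ha, hb⟩ := (mem_neighbourIndices _).1 hp
  simp only [abs_le] at ha hb
  -- The i for which both i and i + c lie in [0, k); at most one index is lost when |c| ≤ 1.
  let I : ℤ → Finset ℤ := fun c => Finset.Ico (max 0 (-c)) (min k (k - c))
  have hI : ∀ c : ℤ, -1 ≤ c ∧ c ≤ 1 → k - 1 ≤ (I c).card := by
    intro c hc
    simp only [I, Int.card_Ico]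
    omega
  calc (k - 1) ^ 2 ≤ (I a).card * (I b).card := by
        rw [sq]; exact Nat.mul_le_mul (hI a ha) (hI b hb)
    _ = ((I a ×ˢ I b).image latticePoint).card := by
        rw [Finset.card_image_of_injective _ latticePoint_injective, Finset.card_product]
    _ ≤ _ := by
        refine Finset.card_le_card fun x hx => ?_
        obtain ⟨⟨i, j⟩, hq, rfl⟩ := Finset.mem_image.1 hx
        simp only [I, Finset.mem_product, Finset.mem_Ico] at hq
        rw [Finset.mem_filter, ← latticePoint_add]
        refine ⟨Finset.mem_image_of_mem _ ?_, Finset.mem_image_of_mem _ ?_⟩ <;>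
          simp only [Finset.mem_product, Finset.mem_Ico, Prod.mk_add_mk] <;> omega

/-- V is nonpositive at both neighbour distances, so undercounting the pairs bounds the energy from
above. -/
theorem energy_grid_le {V : ℝ → ℝ} (hV : ∀ r, 2 ≤ r → V r = 0) (h1 : V 1 ≤ 0)
    (h2 : V (Real.sqrt 2) ≤ 0) (k : ℕ) :
    energy V (grid k) ≤ (2 * V 1 + 2 * V (Real.sqrt 2)) * ((k - 1 : ℕ) : ℝ) ^ 2 := by
  classical
  rw [energy_eq_sum_card hV (t := 1) (F := neighbours) (fun x hx => ?_) neighbours_ne_zero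
    mem_neighbours]
  · have hneg : ∀ v ∈ neighbours, V ‖v‖ ≤ 0 := by
      intro v hv
      obtain ⟨p, hp, rfl⟩ := Finset.mem_image.1 hv
      rw [norm_latticePoint]
      simp only [neighbourIndices, Finset.mem_insert, Finset.mem_singleton] at hp
      rcases hp with rfl | rfl | rfl | rfl | rfl | rfl | rfl | rfl <;> norm_num <;> assumption
    have : ∑ v ∈ neighbours, V ‖v‖ * (((grid k).filter fun x => x + v ∈ grid k).card : ℝ) ≤
        ∑ v ∈ neighbours, V ‖v‖ * ((k - 1 : ℕ) : ℝ) ^ 2 :=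
      Finset.sum_le_sum fun v hv => mul_le_mul_of_nonpos_left
        (by exact_mod_cast card_grid_inter_ge k hv) (hneg v hv)
    rw [← Finset.sum_mul, sum_neighbours] at this
    linarith
  · obtain ⟨p, hp, rfl⟩ := Finset.mem_image.1 hx
    exact latticePoint_mem p

/-- Use the largest square grid with at most N points and place the remaining points out of range of
everything. -/
theorem exists_energy_le {V : ℝ → ℝ} (hV : ∀ r, 2 ≤ r → V r = 0) (h1 : V 1 ≤ 0)
    (h2 : V (Real.sqrt 2) ≤ 0) (hm : -4 ≤ 2 * V 1 + 2 * V (Real.sqrt 2)) (N : ℕ) :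
    ∃ X : Finset Plane, X.card = N ∧
      energy V X ≤ N * (2 * V 1 + 2 * V (Real.sqrt 2)) + 16 * Real.sqrt N := by
  set k := Nat.sqrt N with hk
  have hk1 : k ^ 2 ≤ N := Nat.sqrt_le' N
  have hk2 : N < (k + 1) ^ 2 := Nat.lt_succ_sqrt' N
  obtain ⟨Z, hZ, hE⟩ := exists_energy_eq_of_card_add hV (grid k) (N - k ^ 2)
  rw [card_grid] at hZ
  refine ⟨Z, by omega, ?_⟩
  rw [hE]
  refine (energy_grid_le hV h1 h2 k).trans ?_
  have hks : (k : ℝ) ≤ Real.sqrt N := Real.nat_sqrt_le_real_sqrt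
  set m := 2 * V 1 + 2 * V (Real.sqrt 2)
  have hm0 : m ≤ 0 := by linarith
  -- This is N < (k + 1)² = (k - 1)² + 4k. Multiplied by m ≥ -4 the excess costs 16k, hence the
  -- constant 16; k = 0 is separate because the subtraction truncates.
  have hN : (N : ℝ) ≤ ((k - 1 : ℕ) : ℝ) ^ 2 + 4 * k := by
    rcases Nat.eq_zero_or_pos k with h | h
    · rw [h] at hk2 ⊢
      have : N = 0 := by omega
      simp [this]
    · rw [Nat.cast_sub h, Nat.cast_one]
      have : (N : ℝ) + 1 ≤ ((k : ℝ) + 1) ^ 2 := by exact_mod_cast hk2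
      linarith
  have h5 : m * (((k - 1 : ℕ) : ℝ) ^ 2 + 4 * k) ≤ m * N := mul_le_mul_of_nonpos_left hN hm0
  have h6 : -4 * (4 * (k : ℝ)) ≤ m * (4 * k) := by gcongr
  linarith

/-! ### Existence of minimizers -/

theorem energy_image_univ (V : ℝ → ℝ) [DecidableEq Plane] {N : ℕ} {x : Fin N → Plane}
    (hx : Function.Injective x) : energy V (Finset.univ.image x) =
      1 / 2 * ∑ p ∈ (Finset.univ : Finset (Fin N)).offDiag, V (dist (x p.1) (x p.2)) := by
  unfold energy
  congr 1
  symm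
  refine Finset.sum_bij (fun p _ => (x p.1, x p.2)) ?_ ?_ ?_ ?_
  · intro p hp
    rw [Finset.mem_offDiag] at hp
    simpa [Finset.mem_offDiag] using hx.ne hp.2.2
  · intro p _ q _ h
    exact Prod.ext (hx (Prod.ext_iff.1 h).1) (hx (Prod.ext_iff.1 h).2)
  · rintro ⟨a, b⟩ hab
    simp only [Finset.mem_offDiag, Finset.mem_image, Finset.mem_univ, true_and] at hab
    obtain ⟨⟨i, rfl⟩, ⟨j, rfl⟩, hne⟩ := hab
    exact ⟨(i, j), by simpa [Finset.mem_offDiag] using fun h => hne (by rw [h]), rfl⟩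
  · intro p _; rfl

/-- Among the separated configurations in a ball there is one of minimal energy. -/
theorem exists_min_energy_of_separated {V : ℝ → ℝ} (hV : LowerSemicontinuousOn V (Ioi 0))
    {δ R : ℝ} (hδ : 0 < δ) {N : ℕ}
    (hne : ∃ Y : Finset Plane, Y.card = N ∧ Separated δ Y ∧ ∀ y ∈ Y, ‖y‖ ≤ R) :
    ∃ W : Finset Plane, W.card = N ∧ ∀ Y : Finset Plane, Y.card = N → Separated δ Y →
      (∀ y ∈ Y, ‖y‖ ≤ R) → energy V W ≤ energy V Y := by
  classical
  let S : Set (Fin N → Plane) := {x | (∀ i, ‖x i‖ ≤ R) ∧ ∀ i j, i ≠ j → δ ≤ dist (x i) (x j)}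
  have hinj : ∀ x ∈ S, Function.Injective x := by
    intro x hx i j hij
    by_contra hne
    have := hx.2 i j hne
    rw [hij, dist_self] at this
    linarith
  have hrep : ∀ Y : Finset Plane, Y.card = N → Separated δ Y → (∀ y ∈ Y, ‖y‖ ≤ R) →
      ∃ x ∈ S, Finset.univ.image x = Y := by
    intro Y hY hsep hR
    let e := (Y.equivFinOfCardEq hY).symm
    refine ⟨fun i => e i, ⟨fun i => hR _ (e i).2, fun i j hij => hsep _ (e i).2 _ (e j).2
      fun h => hij (e.injective (Subtype.ext h))⟩, ?_⟩
    ext y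
    simp only [Finset.mem_image, Finset.mem_univ, true_and]
    constructor
    · rintro ⟨i, rfl⟩; exact (e i).2
    · intro hy; exact ⟨e.symm ⟨y, hy⟩, by simp⟩
  have hclosed : IsClosed S := by
    have : S = (⋂ i, {x | ‖x i‖ ≤ R}) ∩ ⋂ i, ⋂ j, ⋂ (_ : i ≠ j), {x | δ ≤ dist (x i) (x j)} := by
      ext x; simp [S]
    rw [this]
    refine (isClosed_iInter fun i => isClosed_le (by fun_prop) (by fun_prop)).inter
      (isClosed_iInter fun i => isClosed_iInter fun j => isClosed_iInter fun _ =>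
        isClosed_le (by fun_prop) (by fun_prop))
  have hcompact : IsCompact S := by
    refine Metric.isCompact_of_isClosed_isBounded hclosed
      ((Metric.isBounded_closedBall (x := (0 : Fin N → Plane)) (r := |R|)).subset fun x hx => ?_)
    rw [mem_closedBall_zero_iff, pi_norm_le_iff_of_nonneg (abs_nonneg R)]
    exact fun i => (hx.1 i).trans (le_abs_self R)
  have hlsc : LowerSemicontinuousOn (fun x : Fin N → Plane =>
      ∑ p ∈ (Finset.univ : Finset (Fin N)).offDiag, V (dist (x p.1) (x p.2))) S := by
    refine lowerSemicontinuousOn_sum fun p hp => ?_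
    refine hV.comp (g := fun x : Fin N → Plane => dist (x p.1) (x p.2)) ?_ ?_
    · fun_prop
    · intro x hx
      exact hδ.trans_le (hx.2 _ _ (Finset.mem_offDiag.1 hp).2.2)
  obtain ⟨Y, hY, hsep, hR⟩ := hne
  obtain ⟨x, hx, -⟩ := hrep Y hY hsep hR
  obtain ⟨w, hw, hmin⟩ := hlsc.exists_isMinOn ⟨x, hx⟩ hcompact
  refine ⟨Finset.univ.image w, ?_, fun Y hY hsep hR => ?_⟩
  · rw [Finset.card_image_of_injective _ (hinj w hw), Finset.card_univ, Fintype.card_fin]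
  · obtain ⟨x, hx, rfl⟩ := hrep Y hY hsep hR
    rw [energy_image_univ V (hinj w hw), energy_image_univ V (hinj x hx)]
    have := isMinOn_iff.1 hmin x hx
    linarith

/-- A configuration of large diameter splits into two parts that do not interact. -/
theorem exists_split {V : ℝ → ℝ} (hV : ∀ r, 2 ≤ r → V r = 0) {Y : Finset Plane} {p y : Plane}
    (hp : p ∈ Y) (hy : y ∈ Y) (hfar : 2 * (Y.card : ℝ) < dist p y) :
    ∃ Y₁ Y₂ : Finset Plane, 0 < Y₁.card ∧ 0 < Y₂.card ∧ Y₁.card + Y₂.card = Y.card ∧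
      energy V Y = energy V Y₁ + energy V Y₂ := by
  classical
  -- Pigeonhole: y lies beyond the first #Y annuli of width 2 about p, so the remaining #Y - 1
  -- points leave one of them empty.
  obtain ⟨k, hk, hgap⟩ : ∃ k < Y.card, ∀ z ∈ Y, ⌊dist p z / 2⌋₊ ≠ k := by
    by_contra! h
    have hsub : Finset.range Y.card ⊆ (Y.erase y).image fun z => ⌊dist p z / 2⌋₊ := by
      intro k hk
      obtain ⟨z, hz, hzk⟩ := h k (Finset.mem_range.1 hk)
      refine Finset.mem_image.2 ⟨z, Finset.mem_erase.2 ⟨?_, hz⟩, hzk⟩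
      rintro rfl
      have h1 := (Nat.floor_lt (by positivity)).1 (hzk.trans_lt (Finset.mem_range.1 hk))
      linarith
    have h1 := (Finset.card_le_card hsub).trans Finset.card_image_le
    rw [Finset.card_range, Finset.card_erase_of_mem hy] at h1
    have := Finset.card_pos.2 ⟨y, hy⟩
    omega
  have hk0 : 0 < k := by
    rcases Nat.eq_zero_or_pos k with rfl | h
    · exact absurd (by simp) (hgap p hp)
    · exact h
  have hgap' : ∀ z ∈ Y, ¬dist p z < 2 * k → 2 * (k : ℝ) + 2 ≤ dist p z := by
    intro z hz h
    by_contra h2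
    refine hgap z hz ((Nat.floor_eq_iff (by positivity)).2 ⟨by linarith, by linarith⟩)
  refine ⟨Y.filter fun z => dist p z < 2 * k, Y.filter fun z => ¬dist p z < 2 * k, ?_, ?_,
    Finset.card_filter_add_card_filter_not _, ?_⟩
  · exact Finset.card_pos.2 ⟨p, Finset.mem_filter.2 ⟨hp, by
      rw [dist_self]; positivity⟩⟩
  · refine Finset.card_pos.2 ⟨y, Finset.mem_filter.2 ⟨hy, ?_⟩⟩
    have : (k : ℝ) ≤ Y.card := by exact_mod_cast hk.le
    linarith
  · have := energy_union V (Finset.disjoint_filter_filter_not Y Y fun z => dist p z < 2 * k)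
    rw [Finset.filter_union_filter_not_eq] at this
    rw [this, Finset.sum_eq_zero, add_zero]
    intro a ha
    refine Finset.sum_eq_zero fun b hb => hV _ ?_
    rw [Finset.mem_filter] at ha hb
    have := hgap' b hb.1 hb.2
    have := dist_triangle p a b
    linarith

/-- Strong induction on N. Configurations with a removable point or a wide gap are no better than
two smaller minimizers placed far apart; the others can be translated into a fixed ball, where
compactness applies. Finitely many candidates remain. -/
theorem IsSquareLike.exists_min_energy {V : ℝ → ℝ} {ε m : ℝ} (hV : IsSquareLike V ε m)
    (hlsc : LowerSemicontinuousOn V (Ioi 0)) (N : ℕ) :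
    ∃ X : Finset Plane, X.card = N ∧ ∀ Y : Finset Plane, Y.card = N →
      energy V X ≤ energy V Y := by
  classical
  have h0 := hV.pos
  have h1 := hV.le
  induction N using Nat.strong_induction_on with
  | _ N ih =>
  have hsplit : ∀ a, ∃ W : Finset Plane, 0 < a → a < N → W.card = N ∧ ∀ Y₁ Y₂ : Finset Plane,
      Y₁.card = a → Y₂.card = N - a → energy V W ≤ energy V Y₁ + energy V Y₂ := by
    intro a
    by_cases ha : 0 < a ∧ a < N
    · obtain ⟨X₁, c₁, m₁⟩ := ih a ha.2
      obtain ⟨X₂, c₂, m₂⟩ := ih (N - a) (by omega)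
      obtain ⟨W, hW, hE⟩ := exists_energy_add hV.range X₁ X₂
      exact ⟨W, fun _ _ => ⟨by omega, fun Y₁ Y₂ h₁ h₂ => by
        rw [hE]; exact add_le_add (m₁ _ h₁) (m₂ _ h₂)⟩⟩
    · exact ⟨∅, fun h h' => absurd ⟨h, h'⟩ ha⟩
  choose W hW using hsplit
  have hcomp : ∃ W₀ : Finset Plane, (W₀.card = N ∨ ∀ Y : Finset Plane, Y.card = N →
      ¬(Separated (1 - ε) Y ∧ ∀ y ∈ Y, ‖y‖ ≤ 2 * N)) ∧ ∀ Y : Finset Plane, Y.card = N →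
      Separated (1 - ε) Y → (∀ y ∈ Y, ‖y‖ ≤ 2 * N) → energy V W₀ ≤ energy V Y := by
    by_cases hne : ∃ Y : Finset Plane, Y.card = N ∧ Separated (1 - ε) Y ∧ ∀ y ∈ Y, ‖y‖ ≤ 2 * N
    · obtain ⟨W₀, h2, h3⟩ := exists_min_energy_of_separated hlsc (by linarith) hne
      exact ⟨W₀, Or.inl h2, h3⟩
    · push Not at hne
      refine ⟨∅, Or.inr fun Y hY h => ?_, fun Y hY h h' => ?_⟩
      · obtain ⟨y, hy, hy2⟩ := hne Y hY h.1
        linarith [h.2 y hy]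
      · obtain ⟨y, hy, hy2⟩ := hne Y hY h
        linarith [h' y hy]
  obtain ⟨W₀, hW₀, hmin₀⟩ := hcomp
  -- The cardinality filter discards the default values of `W` and `W₀`, which need not have N
  -- points.
  set C : Finset (Finset Plane) :=
    ((Finset.Ioo 0 N).image W ∪ {W₀}).filter fun X => X.card = N with hC
  have hall : ∀ Y : Finset Plane, Y.card = N → ∃ X ∈ C, energy V X ≤ energy V Y := by
    intro Y hY
    have hcase : ∀ Y₁ Y₂ : Finset Plane, 0 < Y₁.card → 0 < Y₂.card → Y₁.card + Y₂.card = N →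
        energy V Y₁ + energy V Y₂ ≤ energy V Y → ∃ X ∈ C, energy V X ≤ energy V Y := by
      intro Y₁ Y₂ h2 h3 h4 h5
      obtain ⟨h6, h7⟩ := hW Y₁.card h2 (by omega)
      refine ⟨W Y₁.card, ?_, (h7 Y₁ Y₂ rfl (by omega)).trans h5⟩
      rw [hC, Finset.mem_filter, Finset.mem_union]
      exact ⟨Or.inl (Finset.mem_image_of_mem _ (Finset.mem_Ioo.2 ⟨h2, by omega⟩)), h6⟩
    by_cases hsep : Separated (1 - ε) Y
    · rcases Y.eq_empty_or_nonempty with rfl | ⟨p, hp⟩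
      · have hs : Separated (1 - ε) ∅ ∧ ∀ y ∈ (∅ : Finset Plane), ‖y‖ ≤ 2 * N := by
          simp [Separated]
        refine ⟨W₀, ?_, hmin₀ _ hY hs.1 hs.2⟩
        rw [hC, Finset.mem_filter, Finset.mem_union]
        exact ⟨Or.inr (by simp), hW₀.resolve_right fun h => h _ hY hs⟩
      · by_cases hb : ∀ y ∈ Y, dist p y ≤ 2 * Y.card
        · set Z := Y.image fun y => y + -p with hZ
          have hZc : Z.card = N := by
            rw [hZ, Finset.card_image_of_injective _ (add_left_injective _), hY]
          have hs : Separated (1 - ε) Z ∧ ∀ y ∈ Z, ‖y‖ ≤ 2 * N := by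
            constructor
            · intro x hx y hy hxy
              obtain ⟨x, hx', rfl⟩ := Finset.mem_image.1 hx
              obtain ⟨y, hy', rfl⟩ := Finset.mem_image.1 hy
              rw [dist_add_right]
              exact hsep _ hx' _ hy' fun h => hxy (by rw [h])
            · intro y hy
              obtain ⟨y, hy', rfl⟩ := Finset.mem_image.1 hy
              rw [← sub_eq_add_neg, ← dist_eq_norm, dist_comm, ← hY]
              exact hb y hy'
          refine ⟨W₀, ?_, (hmin₀ _ hZc hs.1 hs.2).trans_eq (energy_image_add V Y _)⟩
          rw [hC, Finset.mem_filter, Finset.mem_union]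
          exact ⟨Or.inr (by simp), hW₀.resolve_right fun h => h _ hZc hs⟩
        · push Not at hb
          obtain ⟨y, hy, hfar⟩ := hb
          obtain ⟨Y₁, Y₂, h2, h3, h4, h5⟩ := exists_split hV.range hp hy hfar
          exact hcase Y₁ Y₂ h2 h3 (h4.trans hY) h5.ge
    · obtain ⟨x, hx, hpos⟩ := hV.exists_removable hsep
      have hne : (Y.erase x).Nonempty := by
        by_contra h
        rw [Finset.not_nonempty_iff_eq_empty.1 h] at hpos
        simp at hpos
      refine hcase (Y.erase x) {x} hne.card_pos (by simp) ?_ ?_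
      · rw [Finset.card_singleton, Finset.card_erase_add_one hx, hY]
      · rw [energy_singleton, energy_eq_erase V hx]; linarith
  obtain ⟨Y, hY, -⟩ := exists_energy_eq_of_card_add hV.range ∅ N
  obtain ⟨X₀, hX₀, -⟩ := hall Y (by simpa using hY)
  obtain ⟨X, hX, hmin⟩ := C.exists_min_image (energy V) ⟨X₀, hX₀⟩
  refine ⟨X, (Finset.mem_filter.1 hX).2, fun Y hY => ?_⟩
  obtain ⟨Z, hZ, hle⟩ := hall Y hY
  exact (hmin Z hZ).trans hle

/-! ### Assembly of the theorem -/

theorem theorem3p15 :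
    ∃ C₃ αbar : ℝ, 1 ≤ C₃ ∧ 0 < αbar ∧
      ∀ α α'' : ℝ, 0 < α → α < α'' / C₃ → α'' < (2 - Real.sqrt 2) / 4 → α'' < αbar →
        ∃ K : ℝ, 0 < K ∧
          ∀ α' : ℝ, 0 < α' → α' < α →
            ∀ V : ℝ → ℝ, FiniteRangeConditions V α' α α'' K →
              SquareIsOnlyMinimizer V α'' →
                (∀ (t : ℝ) (ht : 0 < t), ∃ l : ℝ, IsLatticeEnergy V ht l) ∧
                IsLeast (latticeEnergies V) (squareEnergy V) ∧
                (∀ N : ℕ, IsGLB (configEnergies V N) (minEnergy V N)) ∧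
                (LowerSemicontinuousOn V (Ioi 0) →
                  ∀ N : ℕ, IsLeast (configEnergies V N) (minEnergy V N)) ∧
                (∃ C : ℝ, ∀ N : ℕ,
                  (N : ℝ) * squareEnergy V ≤ minEnergy V N ∧
                  minEnergy V N ≤ (N : ℝ) * squareEnergy V + C * Real.sqrt N) ∧
                IsLeast (quadEnergies V) (squareEnergy V) ∧
                IsQuadrilateral unitSquare ∧
                fourPointEnergy V unitSquare = squareEnergy V := by
  -- The choice C₃ = 1000 ensures 3α ≤ 1/1000 and 48α < α''; the repulsion 200 is what the 81-cell
  -- count requires.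
  refine ⟨1000, 1, by norm_num, one_pos, fun α α'' _ h2 h3 _ => ⟨200, by norm_num, ?_⟩⟩
  intro α' hα' hα V hfr hmin
  have hV := hfr.isSquareLike hα' hα h2 h3 hmin
  have he := fourPointEnergy_unitSquare V
  set m := fourPointEnergy V unitSquare with hm
  have s2 : (0 : ℝ) < Real.sqrt 2 := by positivity
  have hV1 : V 1 ≤ 0 := by
    have := hV.ge _ s2
    have := hV.m_le
    linarith
  have hV2 : V (Real.sqrt 2) ≤ 0 := by
    have := hV.ge _ one_pos
    have := hV.m_le
    linarith
  have hleast : IsLeast (latticeEnergies V) m := by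
    refine ⟨⟨1, one_pos, ?_⟩, ?_⟩
    · have := isLatticeEnergy_sum hV.range one_pos neighbours_ne_zero neighbours_mem mem_neighbours
      rw [sum_neighbours] at this
      rw [he]
      convert this using 1
      ring
    -- Every term of the limit obeys the universal lower bound, hence so does the energy per point
    -- for each t.
    · rintro l ⟨t, ht, hl⟩
      refine ge_of_tendsto hl ?_
      filter_upwards [eventually_gt_atTop 0] with R hR
      have hpos : (0 : ℝ) < (latticeBall ht R).card := by
        refine Nat.cast_pos.2 (Finset.card_pos.2 ⟨0, (mem_latticeBall ht).2 ⟨⟨0, 0, ?_⟩, ?_⟩⟩)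
        · apply plane_ext <;> simp
        · simpa using hR
      rw [le_div_iff₀ hpos, mul_comm]
      exact hV.le_energy _ _ rfl
  have hsq : squareEnergy V = m := hleast.csInf_eq
  have hglb : ∀ N : ℕ, IsGLB (configEnergies V N) (minEnergy V N) := by
    intro N
    refine isGLB_csInf ?_ ⟨N * m, ?_⟩
    · obtain ⟨X, hX, -⟩ := exists_energy_eq_of_card_add hV.range ∅ N
      exact ⟨_, X, by simpa using hX, rfl⟩
    · rintro _ ⟨X, hX, rfl⟩
      exact hV.le_energy N X hX
  rw [hsq]
  refine ⟨fun t ht => exists_isLatticeEnergy hV.range ht, hleast, hglb, ?_, ⟨16, fun N => ⟨?_, ?_⟩⟩,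
    ⟨⟨unitSquare, isQuadrilateral_unitSquare, rfl⟩, ?_⟩, isQuadrilateral_unitSquare, rfl⟩
  · intro hlsc N
    obtain ⟨X, hX, hXmin⟩ := hV.exists_min_energy hlsc N
    have hl : IsLeast (configEnergies V N) (energy V X) := by
      refine ⟨⟨X, hX, rfl⟩, ?_⟩
      rintro _ ⟨Y, hY, rfl⟩
      exact hXmin Y hY
    rwa [(hglb N).unique hl.isGLB]
  · refine (hglb N).2 ?_
    rintro _ ⟨X, hX, rfl⟩
    exact hV.le_energy N X hX
  · obtain ⟨X, hX, hE⟩ := exists_energy_le hV.range hV1 hV2 (by rw [← he]; exact hV.m_ge) N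
    rw [← he] at hE
    exact ((hglb N).1 ⟨X, hX, rfl⟩).trans hE
  · rintro _ ⟨x, hx, rfl⟩
    exact hV.le_fourPointEnergy hx
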